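/- **Setting.** For $d\ge 2$ let $SU(d)$ be the special unitary group with the metric $\|g-h\|$ given by the operator norm on $\mathbb C^d$, and with normalised Haar measure; $\|\cdot\|_2$ is the norm of $L^2(SU(d))$, and for Lipschitz $f:SU(d)\to\mathbb C$, $\|f\|_{\rm Lip}$ is the least Lipschitz constant of $f$. Identify $\{0,\dots,d-1\}$ with $\mathbb Z/d\mathbb Z$. For $i\ne j$ and $\gamma\in SU(2)$ let $\gamma_{ij}\in SU(d)$ act as $\gamma$ on the span of the ordered basis $(e_i,e_j)$ and fix $e_k$ for $k\notin\{i,j\}$. Given a Borel probability measure $\eta$ on $SU(2)$, let $\nu_{ij}$ be the image of $\eta$ under $\gamma\mapsto\gamma_{ij}$, and put $$\nu=\frac1d\sum_{i\in\mathbb Z/d\mathbb Z}\nu_{i,i+1},\qquad Tf(x)=\frac1d\sum_{i\in\mathbb Z/d\mathbb Z}\int f(gx)\,\nu_{i,i+1}(dg).$$ **Proposition 1′.** There are absolute constants $C,A>0$ such that, for every Borel probability measure $\eta$ on $SU(2)$ whose support generates a dense subgroup of $SU(2)$, there is a constant $c>0$ depending only on $\eta$ with the following property. Let $d\ge 4$;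 or let $d\in\{2,3\}$ and assume in addition that $\operatorname{supp}(\tilde\nu*\nu)$ generates a dense subgroup of $SU(d)$, where $\tilde\nu$ is the image of $\nu$ under $g\mapsto g^{-1}$. Then for every Lipschitz function $f:SU(d)\to\mathbb C$ with $\|f\|_2=1$ and $\int_{SU(d)}f=0$, $$\|Tf\|_2<1-(cd)^{-C}\,\bigl(\log(1+\|f\|_{\rm Lip})\bigr)^{-A}.$$ -/

import Mathlib

open MeasureTheory
open scoped ENNReal NNReal Matrix Matrix.Norms.L2Operator

noncomputable section

namespace LargeSU

/-- The special unitary group `SU(d)`. It carries the metric `‖g - h‖` given by the operator norm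
of matrices acting on the Hermitian space `ℂ^d` (and hence its usual topology). -/
abbrev SU (d : ℕ) : Type := Matrix.specialUnitaryGroup (Fin d) ℂ

instance instMeasurableSpaceSU (d : ℕ) : MeasurableSpace (SU d) := borel (SU d)

instance instBorelSpaceSU (d : ℕ) : BorelSpace (SU d) := ⟨rfl⟩

instance instIsTopologicalGroupSU (d : ℕ) : IsTopologicalGroup (SU d) where
  continuous_mul := continuous_mul
  continuous_inv := by
    refine Continuous.subtype_mk (f := fun A : SU d => star (A : Matrix (Fin d) (Fin d) ℂ)) ?_ _
    exact continuous_star.comp continuous_subtype_val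

instance instCompactSpaceSU (d : ℕ) : CompactSpace (SU d) := by
  refine isCompact_iff_compactSpace.mp ?_
  refine Metric.isCompact_of_isClosed_isBounded ?_ ?_
  · have h : ((Matrix.specialUnitaryGroup (Fin d) ℂ : Submonoid _) : Set (Matrix (Fin d) (Fin d) ℂ))
        = {A | A * star A = 1} ∩ {A | A.det = 1} := by
      ext A
      simp only [SetLike.mem_coe, Matrix.mem_specialUnitaryGroup_iff, Matrix.mem_unitaryGroup_iff]
      rfl
    rw [h]
    refine IsClosed.inter ?_ ?_
    · exact isClosed_eq (continuous_id.mul continuous_star) continuous_const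
    · exact isClosed_eq (Continuous.matrix_det continuous_id) continuous_const
  · refine (Metric.isBounded_closedBall (x := (0 : Matrix (Fin d) (Fin d) ℂ)) 
      (r := 1 + ‖(1 : Matrix (Fin d) (Fin d) ℂ)‖)).subset ?_
    intro A hA
    rw [mem_closedBall_zero_iff]
    have h1 : ‖star A * A‖ = ‖A‖ * ‖A‖ := CStarRing.norm_star_mul_self
    rw [hA.1.1] at h1
    nlinarith [sq_nonneg (‖A‖ - 1)]

/-- Normalised Haar measure on `SU(d)` (total mass one). -/
def haarSU (d : ℕ) : Measure (SU d) := Measure.haarMeasure ⊤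

/-- The matrix `V` of the isometry `ℂ² → ℂ^d` with `V e₀ = e_i` and `V e₁ = e_j`. -/
def pairMatrix {d : ℕ} (i j : Fin d) : Matrix (Fin d) (Fin 2) ℂ :=
  Matrix.of fun k a => if k = ![i, j] a then 1 else 0

theorem pairMatrix_isometry {d : ℕ} {i j : Fin d} (hij : i ≠ j) :
    (pairMatrix i j)ᴴ * pairMatrix i j = 1 := by
  ext a b
  rw [Matrix.mul_apply, Finset.sum_eq_single (![i, j] a)]
  · fin_cases a <;> fin_cases b <;> simp [pairMatrix, hij, hij.symm]
  · intro k _ hk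
    simp [pairMatrix, hk]
  · simp

/-- For `i ≠ j` and `γ ∈ SU(2)`, the element `γ_{ij}` of `SU(d)`: it acts as `γ` on the span of the
ordered basis `(e_i, e_j)` and fixes `e_k` for `k ∉ {i, j}`. With `V` the isometry
`e₀ ↦ e_i`, `e₁ ↦ e_j`, this is `1 + V (γ - 1) Vᴴ`. -/
def embedPair {d : ℕ} {i j : Fin d} (hij : i ≠ j) (γ : SU 2) : SU d :=
  ⟨1 + pairMatrix i j * (γ.1 - 1) * (pairMatrix i j)ᴴ, by
    have hV := pairMatrix_isometry hij
    obtain ⟨hu, hdet⟩ := Matrix.mem_specialUnitaryGroup_iff.mp γ.2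
    rw [Matrix.mem_unitaryGroup_iff] at hu
    set V := pairMatrix i j
    set g : Matrix (Fin 2) (Fin 2) ℂ := γ.1
    refine Matrix.mem_specialUnitaryGroup_iff.mpr ⟨?_, ?_⟩
    · rw [Matrix.mem_unitaryGroup_iff]
      have hs : star (1 + V * (g - 1) * Vᴴ) = 1 + V * (star g - 1) * Vᴴ := by
        simp [Matrix.star_eq_conjTranspose, Matrix.conjTranspose_mul, Matrix.mul_assoc]
      have hm : V * (g - 1) * Vᴴ * (V * (star g - 1) * Vᴴ)
          = V * ((g - 1) * (star g - 1)) * Vᴴ := by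
        calc V * (g - 1) * Vᴴ * (V * (star g - 1) * Vᴴ)
            = V * (g - 1) * (Vᴴ * V) * (star g - 1) * Vᴴ := by simp only [Matrix.mul_assoc]
          _ = V * ((g - 1) * (star g - 1)) * Vᴴ := by
            rw [hV]; simp only [Matrix.mul_assoc, Matrix.one_mul]
      have hz : (g - 1) + (star g - 1) + (g - 1) * (star g - 1) = 0 := by
        rw [sub_mul, mul_sub, hu]; simp
      rw [hs, add_mul, mul_add, mul_add, hm, one_mul, one_mul, mul_one, add_assoc]
      have : V * (star g - 1) * Vᴴ + (V * (g - 1) * Vᴴ + V * ((g - 1) * (star g - 1)) * Vᴴ)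
          = V * ((g - 1) + (star g - 1) + (g - 1) * (star g - 1)) * Vᴴ := by
        simp only [Matrix.mul_add, Matrix.add_mul]; abel
      rw [this, hz]; simp
    · rw [Matrix.mul_assoc, Matrix.det_one_add_mul_comm, Matrix.mul_assoc, hV, Matrix.mul_one,
        add_sub_cancel, hdet]⟩

/-- `ν_{ij}`: the measure `η` on `SU(2)` made to act on `[e_i, e_j]`, a measure on `SU(d)`. -/
def pairMeasure (η : Measure (SU 2)) {d : ℕ} {i j : Fin d} (hij : i ≠ j) : Measure (SU d) :=
  η.map (embedPair hij)

section Walk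

variable (η : Measure (SU 2)) (d : ℕ) [d.AtLeastTwo]

/-- Addition in `Fin d` is modulo `d`, so `i + 1` is the cyclic successor of `i`. -/
theorem ne_succ {d : ℕ} [d.AtLeastTwo] (i : Fin d) : i ≠ i + 1 := by
  have h : 2 ≤ d := Nat.AtLeastTwo.prop
  simpa using (by omega : d ≠ 1)

/-- `T f (x) = d⁻¹ ∑_{i ∈ ℤ/d} ∫ f (g x) ν_{i,i+1}(dg)`. -/
def avgOp (f : SU d → ℂ) (x : SU d) : ℂ :=
  (1 / (d : ℂ)) * ∑ i : Fin d, ∫ g, f (g * x) ∂(pairMeasure η (ne_succ i))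

/-- The step distribution `ν = d⁻¹ ∑_{i ∈ ℤ/d} ν_{i,i+1}` of the random walk on `SU(d)`. -/
def stepMeasure : Measure (SU d) :=
  (d : ℝ≥0∞)⁻¹ • ∑ i : Fin d, pairMeasure η (ne_succ i)

end Walk

/-- `‖f‖_Lip`: the least Lipschitz constant of `f` for the operator norm distance on `SU(d)`. -/
def lipNorm {d : ℕ} (f : SU d → ℂ) : ℝ≥0 := sInf {K : ℝ≥0 | LipschitzWith K f}

/-- The subgroup generated by the support of `μ` is dense in `SU(d)`. -/
def GeneratesDense {d : ℕ} (μ : Measure (SU d)) : Prop :=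
  Dense (Subgroup.closure μ.support : Set (SU d))

end LargeSU

end

/-! Argue by contradiction and write `Tf` for `avgOp η d f`. If `‖Tf‖₂ ≥ 1 - κ`, the variance
identity `integral_l2Norm_sub_average_sq` says that the translates `f(g·)` lie, in quadratic mean
over the step distribution, within `√(2κ)` of the single vector `Tf`. So `f` is nearly fixed by the
quotients `g h⁻¹` of typical steps. The displacement `ρ(g) = ‖f(g·) - f‖₂` is a length function
(symmetric and subadditive), so it stays small on short words. Once it is below `1/2` on all of
`SU(d)` there is a contradiction: a mean zero function of norm one is moved by more than `1/2` by
some `g` (`exists_displacement_gt`).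

To reach every `g`, density and compactness first give a coarse net of short elements. This is the
role of `Reachable`: the finitely many open sets and the word length are chosen before the length
function, so the constants do not see `f`. The Solovay–Kitaev iteration `exists_solovayKitaev` then
refines the net: a commutator costs four lengths but turns accuracy `t²` into order `t³`, so an
`ε`-net costs only a power of `log(1/ε)`. The Lipschitz bound covers the remaining distance `ε`.

For `d ∈ {2, 3}` density of the quotients is assumed and this runs directly in `SU(d)`. For `d ≥ 4`
only density of the group generated by `supp η` is known, and quotients of elements of `supp η` may
generate too little. But the copy of `SU(2)` on `(i, i+1)` commutes with the one on `(i+2, i+3)`.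
Fix `σ` in the latter with `f(σ·)` near `Tf`; then `γσ⁻¹` is short for typical `γ`. In a commutator
of such words `σ` cancels, and since `SU(2)` is perfect the whole copy on `(i, i+1)` is reached
(`reachable_prod_one`, `displacement_embedPair_le`). Solovay–Kitaev is thus used only inside
`SU(2)`, with constants independent of `d`; Givens elimination and conjugation around the cycle
extend the bound to `SU(d)` at cost `2d³` (`IsLength.le_of_adjacent`). -/

namespace LargeSU

open Filter Topology

/-! ### Length functions on groups and robustly reachable elements -/

/-- A length function on a group: symmetric, subadditive and zero at the identity. -/
structure IsLength {Γ : Type*} [Group Γ] (ρ : Γ → ℝ) : Prop where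
  one : ρ 1 = 0
  inv_le : ∀ g, ρ g⁻¹ ≤ ρ g
  mul_le : ∀ g h, ρ (g * h) ≤ ρ g + ρ h

namespace IsLength

variable {Γ Γ' : Type*} [Group Γ] [Group Γ'] {ρ : Γ → ℝ}

theorem nonneg (hρ : IsLength ρ) (g : Γ) : 0 ≤ ρ g := by
  have h1 := hρ.mul_le g g⁻¹
  have h2 := hρ.inv_le g
  rw [mul_inv_cancel, hρ.one] at h1
  linarith

theorem comp (hρ : IsLength ρ) (φ : Γ' →* Γ) : IsLength fun g => ρ (φ g) where
  one := by simpa using hρ.one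
  inv_le g := by simpa using hρ.inv_le (φ g)
  mul_le g h := by simpa using hρ.mul_le (φ g) (φ h)

/-- The factor four is the price of one commutator in the Solovay–Kitaev iteration. -/
theorem commutator_le (hρ : IsLength ρ) {r : ℝ} {a b : Γ} (ha : ρ a ≤ r) (hb : ρ b ≤ r) :
    ρ (a * b * a⁻¹ * b⁻¹) ≤ 4 * r := by
  have h1 := hρ.mul_le (a * b * a⁻¹) b⁻¹
  have h2 := hρ.mul_le (a * b) a⁻¹
  have h3 := hρ.mul_le a b
  have h4 := hρ.inv_le a
  have h5 := hρ.inv_le b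
  linarith

theorem list_prod_le (hρ : IsLength ρ) {r : ℝ} (l : List Γ) (h : ∀ x ∈ l, ρ x ≤ r) :
    ρ l.prod ≤ l.length * r := by
  induction l with
  | nil => simp [hρ.one]
  | cons a l ih =>
    have h1 := hρ.mul_le a l.prod
    have h2 := h a (by simp)
    have h3 := ih fun x hx => h x (by simp [hx])
    simp only [List.prod_cons, List.length_cons, Nat.cast_add, Nat.cast_one]
    linarith

end IsLength

section Reachable

variable {Γ : Type*} [Group Γ] [TopologicalSpace Γ]

/-- `g` is robustly reachable from `S`: near `g` there are elements of length at most a constant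
times `δ`, for every length function taking values `≤ δ` somewhere in each of finitely many
fixed open sets that meet `S`. -/
def Reachable (S : Set Γ) (g : Γ) : Prop :=
  ∀ U ∈ 𝓝 g, ∃ 𝒱 : Set (Set Γ), 𝒱.Finite ∧ (∀ V ∈ 𝒱, IsOpen V ∧ (S ∩ V).Nonempty) ∧
    ∃ L : ℕ, ∀ ρ : Γ → ℝ, IsLength ρ → ∀ δ : ℝ, (∀ V ∈ 𝒱, ∃ γ ∈ V, ρ γ ≤ δ) →
      ∃ g' ∈ U, ρ g' ≤ L * δ

/-- Reachability is uniform over a compact family. -/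
theorem Reachable.exists_uniform {S : Set Γ} {X : Type*} [PseudoMetricSpace X] [CompactSpace X]
    (i : X → Γ) (hi : ∀ x, Reachable S (i x)) {ε : ℝ} (hε : 0 < ε)
    (hU : ∀ x, i '' Metric.ball x (ε / 2) ∈ 𝓝 (i x)) :
    ∃ 𝒱 : Set (Set Γ), 𝒱.Finite ∧ (∀ V ∈ 𝒱, IsOpen V ∧ (S ∩ V).Nonempty) ∧
      ∃ L : ℕ, ∀ ρ : Γ → ℝ, IsLength ρ → ∀ δ : ℝ, 0 ≤ δ → (∀ V ∈ 𝒱, ∃ γ ∈ V, ρ γ ≤ δ) →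
        ∀ x, ∃ x', dist x x' ≤ ε ∧ ρ (i x') ≤ L * δ := by
  choose 𝒱 hf hV L hL using fun x => hi x _ (hU x)
  obtain ⟨t, -, ht, hcov⟩ := finite_cover_balls_of_compact
    (isCompact_univ (X := X)) (half_pos hε)
  refine ⟨⋃ x ∈ t, 𝒱 x, ht.biUnion fun x _ => hf x, ?_, ∑ x ∈ ht.toFinset, L x,
    fun ρ hρ δ hδ h x => ?_⟩
  · intro V h
    simp only [Set.mem_iUnion] at h
    obtain ⟨x, -, h⟩ := h
    exact hV x V h
  · obtain ⟨y, hyt, hxy⟩ := Set.mem_iUnion₂.mp (hcov (Set.mem_univ x))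
    obtain ⟨-, ⟨x', hx', rfl⟩, h'⟩ := hL y ρ hρ δ fun V hV =>
      h V (Set.mem_biUnion hyt hV)
    refine ⟨x', ?_, h'.trans ?_⟩
    · have := dist_triangle_right x x' y
      rw [Metric.mem_ball] at hxy hx'
      linarith
    · refine mul_le_mul_of_nonneg_right ?_ hδ
      exact_mod_cast Finset.single_le_sum (f := L) (fun _ _ => Nat.zero_le _)
        (ht.mem_toFinset.mpr hyt)

variable [IsTopologicalGroup Γ]

/-- The subgroup of robustly reachable elements. -/
def reachableSubgroup (S : Set Γ) : Subgroup Γ where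
  carrier := {g | Reachable S g}
  one_mem' U hU := ⟨∅, Set.finite_empty, by simp, 0, fun ρ hρ δ _ =>
    ⟨1, mem_of_mem_nhds hU, by simp [hρ.one]⟩⟩
  mul_mem' {a b} ha hb U hU := by
    obtain ⟨Ua, hUa, Ub, hUb, hab⟩ := mem_nhds_prod_iff.mp
      ((continuous_mul (M := Γ)).continuousAt (x := (a, b)) hU)
    obtain ⟨𝒱, hf, hV, L, hL⟩ := ha Ua hUa
    obtain ⟨𝒱', hf', hV', L', hL'⟩ := hb Ub hUb
    refine ⟨𝒱 ∪ 𝒱', hf.union hf', ?_, L + L', fun ρ hρ δ h => ?_⟩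
    · rintro V (h | h)
      exacts [hV V h, hV' V h]
    · obtain ⟨g, hg, hg'⟩ := hL ρ hρ δ fun V hV => h V (Or.inl hV)
      obtain ⟨k, hk, hk'⟩ := hL' ρ hρ δ fun V hV => h V (Or.inr hV)
      refine ⟨g * k, hab (Set.mk_mem_prod hg hk), ?_⟩
      have := hρ.mul_le g k
      push_cast
      linarith
  inv_mem' {a} ha U hU := by
    obtain ⟨𝒱, hf, hV, L, hL⟩ := ha _ ((continuous_inv (G := Γ)).continuousAt (x := a) hU)
    refine ⟨𝒱, hf, hV, L, fun ρ hρ δ h => ?_⟩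
    obtain ⟨g, hg, hg'⟩ := hL ρ hρ δ h
    exact ⟨g⁻¹, hg, (hρ.inv_le g).trans hg'⟩

theorem mem_reachableSubgroup {S : Set Γ} {g : Γ} : g ∈ reachableSubgroup S ↔ Reachable S g :=
  Iff.rfl

/-- Reachability only concerns neighbourhoods of `g`, and a neighbourhood of a limit point is a
neighbourhood of some reachable point. -/
theorem isClosed_reachableSubgroup (S : Set Γ) : IsClosed (reachableSubgroup S : Set Γ) := by
  refine isClosed_of_closure_subset fun g hg U hU => ?_
  obtain ⟨W, hWU, hW, hgW⟩ := mem_nhds_iff.mp hU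
  obtain ⟨k, hkW, hk⟩ := mem_closure_iff.mp hg W hW hgW
  obtain ⟨𝒱, hf, hV, L, hL⟩ := hk W (hW.mem_nhds hkW)
  refine ⟨𝒱, hf, hV, L, fun ρ hρ δ h => ?_⟩
  obtain ⟨g', hg', h'⟩ := hL ρ hρ δ h
  exact ⟨g', hWU hg', h'⟩

theorem subset_reachableSubgroup (S : Set Γ) : S ⊆ reachableSubgroup S := by
  intro s hs U hU
  obtain ⟨W, hWU, hW, hsW⟩ := mem_nhds_iff.mp hU
  refine ⟨{W}, Set.finite_singleton _, ?_, 1, fun ρ hρ δ h => ?_⟩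
  · rintro V rfl
    exact ⟨hW, s, hs, hsW⟩
  · obtain ⟨γ, hγ, h'⟩ := h W rfl
    exact ⟨γ, hWU hγ, by simpa using h'⟩

theorem reachableSubgroup_eq_top {S : Set Γ} (hS : Dense (Subgroup.closure S : Set Γ)) :
    reachableSubgroup S = ⊤ := by
  have h : Dense (reachableSubgroup S : Set Γ) :=
    hS.mono ((Subgroup.closure_le _).mpr (subset_reachableSubgroup S))
  rw [← Subgroup.coe_eq_univ, ← (isClosed_reachableSubgroup S).closure_eq, h.closure_eq]

end Reachable

/-! ### Square-integrable analysis on `SU(d)` -/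

section Analysis

instance instIsHaarMeasureHaarSU (d : ℕ) : (haarSU d).IsHaarMeasure := by
  unfold haarSU; infer_instance

instance instIsProbabilityMeasureHaarSU (d : ℕ) : IsProbabilityMeasure (haarSU d) :=
  ⟨Measure.haarMeasure_self (K₀ := ⊤)⟩

instance instIsMulRightInvariantHaarSU (d : ℕ) : (haarSU d).IsMulRightInvariant where
  map_mul_right_eq_self g := by
    have : IsProbabilityMeasure ((haarSU d).map (· * g)) :=
      -- Compact groups are unimodular: a right translate of Haar measure is again a Haar
      -- probability measure, hence the same one.
      Measure.isProbabilityMeasure_map (by fun_prop)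
    exact Measure.isHaarMeasure_eq_of_isProbabilityMeasure _ _

/-- The variance identity for complex random variables. -/
theorem integral_norm_sub_integral_sq {X : Type*} [MeasurableSpace X] {P : Measure X}
    [IsProbabilityMeasure P] {h : X → ℂ} (hh : MemLp h 2 P) :
    ∫ x, ‖h x - ∫ y, h y ∂P‖ ^ 2 ∂P = ∫ x, ‖h x‖ ^ 2 ∂P - ‖∫ y, h y ∂P‖ ^ 2 := by
  set m := ∫ y, h y ∂P with hm
  have hi : Integrable h P := hh.integrable (by norm_num)
  have hsq : Integrable (fun x => ‖h x‖ ^ 2) P := hh.integrable_norm_pow (by norm_num)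
  have hre : Integrable (fun x => inner ℝ m (h x)) P := hi.const_inner m
  have h1 : ∀ x, ‖h x - m‖ ^ 2 = ‖h x‖ ^ 2 - 2 * inner ℝ m (h x) + ‖m‖ ^ 2 := fun x => by
    rw [norm_sub_sq_real, real_inner_comm]
  have h2 : ∫ x, inner ℝ m (h x) ∂P = ‖m‖ ^ 2 := by
    rw [integral_inner hi, ← hm, real_inner_self_eq_norm_sq]
  have hd : Integrable (fun x => ‖h x‖ ^ 2 - 2 * inner ℝ m (h x)) P := hsq.sub (hre.const_mul 2)
  simp_rw [h1]
  rw [integral_add hd (integrable_const _),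
    integral_sub hsq (hre.const_mul 2), integral_const_mul, h2]
  simp
  ring

variable {d : ℕ}

/-- The `L²` norm on `SU(d)`. -/
noncomputable def l2Norm (u : SU d → ℂ) : ℝ := (eLpNorm u 2 (haarSU d)).toReal

theorem memLp_of_continuous {X : Type*} [TopologicalSpace X] [CompactSpace X] [MeasurableSpace X]
    [BorelSpace X] [SecondCountableTopology X] {P : Measure X}
    [IsFiniteMeasure P] {u : X → ℂ} (hu : Continuous u) : MemLp u 2 P := by
  obtain ⟨C, hC⟩ := isCompact_univ.exists_bound_of_continuousOn hu.continuousOn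
  exact MemLp.of_bound hu.aestronglyMeasurable C (Filter.Eventually.of_forall fun x =>
    hC x (Set.mem_univ x))

theorem l2Norm_sq {u : SU d → ℂ} (hu : Continuous u) :
    l2Norm u ^ 2 = ∫ x, ‖u x‖ ^ 2 ∂(haarSU d) := by
  have hi : (0:ℝ) ≤ ∫ x, ‖u x‖ ^ 2 ∂(haarSU d) := integral_nonneg fun x => by positivity
  have h := (memLp_of_continuous (P := haarSU d) hu).eLpNorm_eq_integral_rpow_norm
    (by norm_num) (by norm_num)
  rw [l2Norm, h, ENNReal.toReal_ofReal (by positivity)]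
  simp only [ENNReal.toReal_ofNat, Real.rpow_ofNat]
  rw [← Real.rpow_natCast, ← Real.rpow_mul hi]
  norm_num

theorem l2Norm_nonneg (u : SU d → ℂ) : 0 ≤ l2Norm u := ENNReal.toReal_nonneg

theorem l2Norm_add_le {u v : SU d → ℂ} (hu : Continuous u) (hv : Continuous v) :
    l2Norm (fun x => u x + v x) ≤ l2Norm u + l2Norm v := by
  have h1 := memLp_of_continuous (P := haarSU d) hu
  have h2 := memLp_of_continuous (P := haarSU d) hv
  rw [l2Norm, l2Norm, l2Norm, ← ENNReal.toReal_add h1.2.ne h2.2.ne]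
  exact ENNReal.toReal_mono (ENNReal.add_ne_top.mpr ⟨h1.2.ne, h2.2.ne⟩)
    (eLpNorm_add_le h1.1 h2.1 (by norm_num))

theorem l2Norm_neg (u : SU d → ℂ) : l2Norm (fun x => -u x) = l2Norm u := by
  rw [l2Norm, l2Norm]; congr 1; exact eLpNorm_neg u 2 _

theorem l2Norm_mul_left {u : SU d → ℂ} (hu : Continuous u) (g : SU d) :
    l2Norm (fun x => u (g * x)) = l2Norm u := by
  rw [l2Norm, l2Norm]
  congr 1
  exact eLpNorm_comp_measurePreserving hu.aestronglyMeasurable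
    (measurePreserving_mul_left (haarSU d) g)

theorem l2Norm_le_of_bound {u : SU d → ℂ} {C : ℝ} (hC : ∀ x, ‖u x‖ ≤ C) : l2Norm u ≤ C := by
  have h0 : 0 ≤ C := (norm_nonneg _).trans (hC 1)
  have := eLpNorm_le_of_ae_bound (p := 2) (μ := haarSU d)
    (Filter.Eventually.of_forall hC)
  rw [l2Norm]
  refine ENNReal.toReal_le_of_le_ofReal h0 (by simpa using this)

/-- `‖f(g·) - f‖₂`. -/
noncomputable def displacement (f : SU d → ℂ) (g : SU d) : ℝ := l2Norm fun x => f (g * x) - f x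

/-- Left translation is an isometry of `L²`, so displacements behave like distances along an orbit
of an isometric action. -/
theorem isLength_displacement {f : SU d → ℂ} (hf : Continuous f) : IsLength (displacement f) where
  one := by simp [displacement, l2Norm]
  inv_le g := by
    have h := l2Norm_mul_left (u := fun x => f (g⁻¹ * x) - f x) (by fun_prop) g
    rw [displacement, ← h, displacement, ← l2Norm_neg]
    simp
  mul_le g h := by
    have h1 := l2Norm_mul_left (u := fun x => f (g * x) - f x) (by fun_prop) h
    have h2 := l2Norm_add_le (u := fun x => f (g * (h * x)) - f (h * x))
      (v := fun x => f (h * x) - f x) (by fun_prop) (by fun_prop)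
    simp only [displacement] at *
    rw [← h1]
    refine le_trans (le_of_eq ?_) h2
    congr 1
    funext x
    rw [mul_assoc]; ring

/-- Translating by `h` turns `f(gh⁻¹·) - f` into `f(g·) - f(h·)`, and both terms are compared with
`F`. It will be applied with `F = Tf`, which need not be close to `f` itself; this is why only
quotients are controlled. -/
theorem displacement_mul_inv_le {f F : SU d → ℂ} (hf : Continuous f) (hF : Continuous F)
    (g h : SU d) : displacement f (g * h⁻¹) ≤
      l2Norm (fun x => f (g * x) - F x) + l2Norm (fun x => f (h * x) - F x) := by
  have h1 := l2Norm_mul_left (u := fun x => f (g * h⁻¹ * x) - f x) (by fun_prop) h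
  rw [displacement, ← h1, ← l2Norm_neg fun x => f (h * x) - F x]
  refine le_trans (le_of_eq ?_) (l2Norm_add_le (by fun_prop) (by fun_prop))
  congr 1
  funext x
  simp

theorem norm_coe_le_one (g : SU d) : ‖(g : Matrix (Fin d) (Fin d) ℂ)‖ ≤ 1 := by
  have h1 : ‖star (g : Matrix (Fin d) (Fin d) ℂ) * g‖ = ‖g.1‖ * ‖g.1‖ :=
    CStarRing.norm_star_mul_self
  rcases d.eq_zero_or_pos with rfl | hd
  · simp [Subsingleton.elim g.1 0]
  · have : Nonempty (Fin d) := ⟨⟨0, hd⟩⟩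
    exact (CStarRing.norm_of_mem_unitary g.2.1).le

theorem dist_eq_norm_coe (g h : SU d) :
    dist g h = ‖(g : Matrix (Fin d) (Fin d) ℂ) - h‖ := by
  rw [Subtype.dist_eq, dist_eq_norm]

theorem dist_mul_right_le (a b g : SU d) : dist (a * g) (b * g) ≤ dist a b := by
  rw [dist_eq_norm_coe, dist_eq_norm_coe]
  calc ‖(a : Matrix (Fin d) (Fin d) ℂ) * g - b * g‖
      = ‖((a : Matrix (Fin d) (Fin d) ℂ) - b) * g‖ := by rw [sub_mul]
    _ ≤ ‖(a : Matrix (Fin d) (Fin d) ℂ) - b‖ * ‖(g : Matrix (Fin d) (Fin d) ℂ)‖ :=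
      norm_mul_le _ _
    _ ≤ _ := mul_le_of_le_one_right (norm_nonneg _) (norm_coe_le_one g)

theorem dist_mul_left_le (a b g : SU d) : dist (g * a) (g * b) ≤ dist a b := by
  rw [dist_eq_norm_coe, dist_eq_norm_coe]
  calc ‖(g : Matrix (Fin d) (Fin d) ℂ) * a - g * b‖
      = ‖(g : Matrix (Fin d) (Fin d) ℂ) * (a - b)‖ := by rw [mul_sub]
    _ ≤ ‖(g : Matrix (Fin d) (Fin d) ℂ)‖ * ‖(a : Matrix (Fin d) (Fin d) ℂ) - b‖ :=
      norm_mul_le _ _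
    _ ≤ _ := mul_le_of_le_one_left (norm_nonneg _) (norm_coe_le_one g)

theorem displacement_le_dist {f : SU d → ℂ} {K : ℝ≥0} (hf : LipschitzWith K f) (g : SU d) :
    displacement f g ≤ K * dist g 1 := by
  refine l2Norm_le_of_bound fun x => ?_
  rw [← dist_eq_norm]
  refine (hf.dist_le_mul _ _).trans (mul_le_mul_of_nonneg_left ?_ K.2)
  simpa using dist_mul_right_le g 1 x

/-- The infimum is attained, because each difference quotient is a lower bound for all Lipschitz
constants. -/
theorem lipschitzWith_lipNorm {f : SU d → ℂ} (hf : ∃ K : ℝ≥0, LipschitzWith K f) :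
    LipschitzWith (lipNorm f) f := by
  refine LipschitzWith.of_dist_le_mul fun x y => ?_
  rcases eq_or_ne (dist x y) 0 with h | h
  · rw [dist_eq_zero] at h
    simp [h]
  have h0 : 0 < dist x y := lt_of_le_of_ne dist_nonneg h.symm
  rw [← div_le_iff₀ h0]
  have : Real.toNNReal (dist (f x) (f y) / dist x y) ≤ lipNorm f :=
    le_csInf hf fun K hK => Real.toNNReal_le_iff_le_coe.mpr
      ((div_le_iff₀ h0).mpr (hK.dist_le_mul x y))
  exact Real.toNNReal_le_iff_le_coe.mp this

theorem norm_integral_sq_le {X : Type*} [MeasurableSpace X] {P : Measure X}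
    [IsProbabilityMeasure P] {h : X → ℂ} (hh : MemLp h 2 P) :
    ‖∫ y, h y ∂P‖ ^ 2 ≤ ∫ x, ‖h x‖ ^ 2 ∂P := by
  have h1 := integral_norm_sub_integral_sq hh
  have h2 : 0 ≤ ∫ x, ‖h x - ∫ y, h y ∂P‖ ^ 2 ∂P := integral_nonneg fun x => by positivity
  linarith

theorem integrable_of_continuous {X E : Type*} [TopologicalSpace X] [CompactSpace X]
    [T2Space X] [MeasurableSpace X] [BorelSpace X] [SecondCountableTopology X]
    [NormedAddCommGroup E] {P : Measure X} [IsFiniteMeasure P] {u : X → E} (hu : Continuous u) : Integrable u P :=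
  integrableOn_univ.mp (hu.continuousOn.integrableOn_compact isCompact_univ)

/-- A mean zero function of norm one is displaced by a definite amount by some element. -/
theorem exists_displacement_gt {f : SU d → ℂ} (hf : Continuous f) (h1 : l2Norm f = 1)
    (h0 : ∫ x, f x ∂(haarSU d) = 0) : ∃ g, 1 / 2 < displacement f g := by
  by_contra! hle
  have hu : Continuous fun p : SU d × SU d => ‖f (p.1 * p.2) - f p.2‖ ^ 2 := by fun_prop
  -- For fixed `x` the mean over `g` of `f(gx) - f(x)` is `-f(x)`, by right invariance and mean
  -- zero; Jensen gives the bound. Integrating over `x`, the mean square displacement is at least 1,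
  -- against `1/4` if every displacement is at most `1/2`.
  have h2 : ∀ x, ‖f x‖ ^ 2 ≤ ∫ g, ‖f (g * x) - f x‖ ^ 2 ∂(haarSU d) := fun x => by
    have h3 : ∫ g, (f (g * x) - f x) ∂(haarSU d) = - f x := by
      rw [integral_sub (integrable_of_continuous (by fun_prop)) (integrable_const _),
        integral_mul_right_eq_self f x, h0]
      simp
    have h4 := norm_integral_sq_le (P := haarSU d) (h := fun g => f (g * x) - f x)
      (memLp_of_continuous (by fun_prop))
    rwa [h3, norm_neg] at h4
  have h5 : ∫ x, ‖f x‖ ^ 2 ∂(haarSU d) ≤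
      ∫ x, ∫ g, ‖f (g * x) - f x‖ ^ 2 ∂(haarSU d) ∂(haarSU d) :=
    integral_mono_of_nonneg (Filter.Eventually.of_forall fun x => by positivity)
      (integrable_of_continuous (P := (haarSU d).prod (haarSU d)) hu).integral_prod_right
      (Filter.Eventually.of_forall h2)
  rw [integral_integral_swap (integrable_of_continuous (P := (haarSU d).prod (haarSU d))
      (u := fun p => ‖f (p.2 * p.1) - f p.1‖ ^ 2) (by fun_prop)), ← l2Norm_sq hf, h1] at h5
  have h6 : ∫ g, ∫ x, ‖f (g * x) - f x‖ ^ 2 ∂(haarSU d) ∂(haarSU d) ≤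
      ∫ _, (1 / 4 : ℝ) ∂(haarSU d) := by
    refine integral_mono_of_nonneg (Filter.Eventually.of_forall fun g => by positivity)
      (integrable_const _) (Filter.Eventually.of_forall fun g => ?_)
    have h7 := l2Norm_sq (u := fun x => f (g * x) - f x) (by fun_prop)
    have h8 := hle g
    have h9 := l2Norm_nonneg fun x => f (g * x) - f x
    rw [displacement] at h8
    simp only [← h7]
    nlinarith
  simp at h6
  norm_num at h5
  linarith

theorem continuous_integral_mul {f : SU d → ℂ} {K : ℝ≥0} (hf : LipschitzWith K f)
    (P : Measure (SU d)) [IsProbabilityMeasure P] : Continuous fun x => ∫ g, f (g * x) ∂P := by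
  have hfc := hf.continuous
  refine LipschitzWith.continuous (K := K) (LipschitzWith.of_dist_le_mul fun x y => ?_)
  rw [dist_eq_norm, ← integral_sub (integrable_of_continuous (by fun_prop))
    (integrable_of_continuous (by fun_prop))]
  refine (norm_integral_le_of_norm_le_const (C := K * dist x y)
    (Filter.Eventually.of_forall fun g => ?_)).trans (by simp)
  rw [← dist_eq_norm]
  exact (hf.dist_le_mul _ _).trans (mul_le_mul_of_nonneg_left (dist_mul_left_le x y g) K.2)

/-- The variance identity for an averaging operator. -/
theorem integral_l2Norm_sub_average_sq {f : SU d → ℂ} {K : ℝ≥0} (hf : LipschitzWith K f)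
    (P : Measure (SU d)) [IsProbabilityMeasure P] :
    ∫ g, l2Norm (fun x => f (g * x) - ∫ h, f (h * x) ∂P) ^ 2 ∂P =
      l2Norm f ^ 2 - l2Norm (fun x => ∫ h, f (h * x) ∂P) ^ 2 := by
  have hfc := hf.continuous
  have hF := continuous_integral_mul hf P
  set F : SU d → ℂ := fun x => ∫ h, f (h * x) ∂P with hFdef
  have h1 : ∀ g, l2Norm (fun x => f (g * x) - F x) ^ 2 =
      ∫ x, ‖f (g * x) - F x‖ ^ 2 ∂(haarSU d) := fun g => l2Norm_sq (by fun_prop)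
  have h2 : ∀ x, ∫ g, ‖f (g * x) - F x‖ ^ 2 ∂P = ∫ g, ‖f (g * x)‖ ^ 2 ∂P - ‖F x‖ ^ 2 :=
    fun x => integral_norm_sub_integral_sq (memLp_of_continuous (by fun_prop))
  have h3 : ∀ g, ∫ x, ‖f (g * x)‖ ^ 2 ∂(haarSU d) = l2Norm f ^ 2 := fun g => by
    rw [← l2Norm_sq (u := fun x => f (g * x)) (by fun_prop), l2Norm_mul_left hfc]
  have hi : Integrable (fun p : SU d × SU d => ‖f (p.2 * p.1)‖ ^ 2) ((haarSU d).prod P) :=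
    integrable_of_continuous (by fun_prop)
  rw [integral_congr_ae (Filter.Eventually.of_forall h1),
    integral_integral_swap (integrable_of_continuous (P := P.prod (haarSU d))
      (u := fun p => ‖f (p.1 * p.2) - F p.2‖ ^ 2) (by fun_prop))]
  simp only [h2]
  rw [integral_sub hi.integral_prod_left (integrable_of_continuous (by fun_prop)),
    integral_integral_swap hi, l2Norm_sq hF]
  simp [h3]

/-- In a set of mass at least `m`, some point does not exceed the mean divided by `m`. -/
theorem exists_mem_le_integral_div {X : Type*} [MeasurableSpace X] {P : Measure X}
    [IsProbabilityMeasure P] {φ : X → ℝ} (hφ : Integrable φ P) (h0 : ∀ x, 0 ≤ φ x) {U : Set X}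
    {m : ℝ} (hm : 0 < m) (hU : m ≤ P.real U) : ∃ x ∈ U, φ x ≤ (∫ y, φ y ∂P) / m := by
  have hU0 : P U ≠ 0 := fun h => by
    have : P.real U = 0 := by simp [Measure.real, h]
    linarith
  obtain ⟨x, hx, h⟩ := exists_le_setAverage hU0 (measure_ne_top _ _) hφ.integrableOn
  refine ⟨x, hx, h.trans ?_⟩
  rw [setAverage_eq, smul_eq_mul, inv_mul_eq_div]
  have h1 : ∫ y in U, φ y ∂P ≤ ∫ y, φ y ∂P :=
    setIntegral_le_integral hφ (Filter.Eventually.of_forall h0)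
  exact div_le_div₀ (integral_nonneg h0) h1 hm hU

theorem continuous_l2Norm_mul_sub {f F : SU d → ℂ} {K : ℝ≥0} (hf : LipschitzWith K f)
    (hF : Continuous F) : Continuous fun g => l2Norm fun x => f (g * x) - F x := by
  have hfc := hf.continuous
  refine LipschitzWith.continuous (K := K) (LipschitzWith.of_le_add_mul _ fun g h => ?_)
  have h1 := l2Norm_add_le (u := fun x => f (h * x) - F x) (v := fun x => f (g * x) - f (h * x))
    (by fun_prop) (by fun_prop)
  have h2 : l2Norm (fun x => f (g * x) - f (h * x)) ≤ K * dist g h :=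
    l2Norm_le_of_bound fun x => by
      rw [← dist_eq_norm]
      exact (hf.dist_le_mul _ _).trans (mul_le_mul_of_nonneg_left (dist_mul_right_le g h x) K.2)
  have h3 : (fun x => f (g * x) - F x) =
      fun x => f (h * x) - F x + (f (g * x) - f (h * x)) := by funext x; ring
  rw [h3]
  exact h1.trans (by gcongr)

end Analysis

/-! ### Embedded copies of `SU(2)` and Givens rotations -/

section Givens

open ComplexConjugate

variable {d : ℕ}

theorem coe_embedPair {i j : Fin d} (hij : i ≠ j) (γ : SU 2) :
    (embedPair hij γ : Matrix (Fin d) (Fin d) ℂ) =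
      1 + pairMatrix i j * (γ.1 - 1) * (pairMatrix i j)ᴴ := rfl

/-- `embedPair` as a group homomorphism. -/
noncomputable def embedPairHom {i j : Fin d} (hij : i ≠ j) : SU 2 →* SU d where
  toFun := embedPair hij
  map_one' := by
    ext1
    rw [coe_embedPair]
    simp
  map_mul' g h := by
    ext1
    have hV := pairMatrix_isometry hij
    rw [Submonoid.coe_mul, coe_embedPair, coe_embedPair, coe_embedPair]
    set V := pairMatrix i j
    have hm : V * (g.1 - 1) * Vᴴ * (V * (h.1 - 1) * Vᴴ) = V * ((g.1 - 1) * (h.1 - 1)) * Vᴴ := by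
      calc V * (g.1 - 1) * Vᴴ * (V * (h.1 - 1) * Vᴴ)
          = V * (g.1 - 1) * (Vᴴ * V) * (h.1 - 1) * Vᴴ := by simp only [Matrix.mul_assoc]
        _ = V * ((g.1 - 1) * (h.1 - 1)) * Vᴴ := by
          rw [hV]; simp only [Matrix.mul_assoc, Matrix.one_mul]
    rw [add_mul, mul_add, mul_add, hm, one_mul, one_mul, mul_one, Submonoid.coe_mul]
    have hz : g.1 * h.1 - 1 = (g.1 - 1) + (h.1 - 1) + (g.1 - 1) * (h.1 - 1) := by
      rw [sub_mul, mul_sub]; simp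
    rw [hz]
    simp only [Matrix.mul_add, Matrix.add_mul]
    abel

@[simp] theorem embedPairHom_apply {i j : Fin d} (hij : i ≠ j) (γ : SU 2) :
    embedPairHom hij γ = embedPair hij γ := rfl

theorem norm_pairMatrix_le {i j : Fin d} (hij : i ≠ j) : ‖pairMatrix i j‖ ≤ 1 := by
  have h : ‖(pairMatrix i j)ᴴ * pairMatrix i j‖ = ‖pairMatrix i j‖ * ‖pairMatrix i j‖ :=
    Matrix.l2_opNorm_conjTranspose_mul_self _
  rw [pairMatrix_isometry hij, norm_one] at h
  nlinarith [norm_nonneg (pairMatrix i j)]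

theorem dist_embedPair_le {i j : Fin d} (hij : i ≠ j) (γ γ' : SU 2) :
    dist (embedPair hij γ) (embedPair hij γ') ≤ dist γ γ' := by
  rw [dist_eq_norm_coe, dist_eq_norm_coe, coe_embedPair, coe_embedPair]
  set V := pairMatrix i j
  have h : 1 + V * (γ.1 - 1) * Vᴴ - (1 + V * (γ'.1 - 1) * Vᴴ) = V * (γ.1 - γ'.1) * Vᴴ := by
    simp only [Matrix.mul_sub, Matrix.sub_mul]; abel
  have hV : ‖V‖ ≤ 1 := norm_pairMatrix_le hij
  rw [h]
  calc ‖V * (γ.1 - γ'.1) * Vᴴ‖ ≤ ‖V * (γ.1 - γ'.1)‖ * ‖Vᴴ‖ := Matrix.l2_opNorm_mul _ _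
    _ ≤ ‖V‖ * ‖γ.1 - γ'.1‖ * ‖Vᴴ‖ := by gcongr; exact Matrix.l2_opNorm_mul _ _
    _ ≤ 1 * ‖γ.1 - γ'.1‖ * 1 := by
      rw [Matrix.l2_opNorm_conjTranspose]; gcongr
    _ = _ := by ring

theorem continuous_embedPair {i j : Fin d} (hij : i ≠ j) : Continuous (embedPair hij) :=
  LipschitzWith.continuous (K := 1)
    (LipschitzWith.of_dist_le_mul fun x y => by simpa using dist_embedPair_le hij x y)

/-- The corrections `V(γ-1)Vᴴ` for disjoint index pairs have orthogonal ranges, so their products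
vanish in both orders. -/
theorem commute_embedPair {i j k l : Fin d} (hij : i ≠ j) (hkl : k ≠ l) (hik : i ≠ k)
    (hil : i ≠ l) (hjk : j ≠ k) (hjl : j ≠ l) (γ γ' : SU 2) :
    Commute (embedPair hij γ) (embedPair hkl γ') := by
  have h0 : ∀ {i j k l : Fin d}, i ≠ k → i ≠ l → j ≠ k → j ≠ l →
      (pairMatrix i j)ᴴ * pairMatrix k l = 0 := by
    intro i j k l h1 h2 h3 h4
    ext a b
    rw [Matrix.mul_apply]
    refine Finset.sum_eq_zero fun m _ => ?_
    fin_cases a <;> fin_cases b <;> simp [pairMatrix] <;> grind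
  have h1 := h0 hik hil hjk hjl
  have h2 := h0 hik.symm hjk.symm hil.symm hjl.symm
  refine Subtype.ext ?_
  rw [Submonoid.coe_mul, Submonoid.coe_mul, coe_embedPair, coe_embedPair]
  set V := pairMatrix i j
  set W := pairMatrix k l
  have h3 : V * (γ.1 - 1) * Vᴴ * (W * (γ'.1 - 1) * Wᴴ) = 0 := by
    rw [show V * (γ.1 - 1) * Vᴴ * (W * (γ'.1 - 1) * Wᴴ) =
      V * (γ.1 - 1) * (Vᴴ * W) * (γ'.1 - 1) * Wᴴ by simp only [Matrix.mul_assoc], h1]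
    simp
  have h4 : W * (γ'.1 - 1) * Wᴴ * (V * (γ.1 - 1) * Vᴴ) = 0 := by
    rw [show W * (γ'.1 - 1) * Wᴴ * (V * (γ.1 - 1) * Vᴴ) =
      W * (γ'.1 - 1) * (Wᴴ * V) * (γ.1 - 1) * Vᴴ by simp only [Matrix.mul_assoc], h2]
    simp
  rw [add_mul, mul_add, mul_add, add_mul, mul_add, mul_add, h3, h4]
  simp only [one_mul, mul_one, add_zero]
  abel

theorem pairMatrix_apply_zero (i j k : Fin d) :
    pairMatrix i j k 0 = if k = i then 1 else 0 := rfl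

theorem pairMatrix_apply_one (i j k : Fin d) :
    pairMatrix i j k 1 = if k = j then 1 else 0 := rfl

theorem pairMatrix_mul_apply (i j : Fin d) (A : Matrix (Fin 2) (Fin 2) ℂ)
    (M : Matrix (Fin d) (Fin d) ℂ) (k l : Fin d) :
    (pairMatrix i j * A * (pairMatrix i j)ᴴ * M) k l =
      (if k = i then A 0 0 * M i l + A 0 1 * M j l else 0) +
        (if k = j then A 1 0 * M i l + A 1 1 * M j l else 0) := by
  have h : ∀ a, ((pairMatrix i j)ᴴ * M) a l = M (![i, j] a) l := by
    intro a
    rw [Matrix.mul_apply, Finset.sum_eq_single (![i, j] a)]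
    · simp [pairMatrix]
    · intro m _ hm
      simp [pairMatrix, hm]
    · simp
  rw [Matrix.mul_assoc, Matrix.mul_assoc, Matrix.mul_apply, Fin.sum_univ_two, Matrix.mul_apply,
    Matrix.mul_apply, Fin.sum_univ_two, Fin.sum_univ_two, h, h]
  rw [pairMatrix_apply_zero, pairMatrix_apply_one, ite_mul, ite_mul]
  simp

theorem embedPair_mul_apply_left {i j : Fin d} (hij : i ≠ j) (γ : SU 2)
    (M : SU d) (l : Fin d) :
    (embedPair hij γ * M).1 i l = γ.1 0 0 * M.1 i l + γ.1 0 1 * M.1 j l := by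
  rw [Submonoid.coe_mul, coe_embedPair, add_mul, one_mul, Matrix.add_apply, pairMatrix_mul_apply]
  simp [hij]
  ring

theorem embedPair_mul_apply_right {i j : Fin d} (hij : i ≠ j) (γ : SU 2)
    (M : SU d) (l : Fin d) :
    (embedPair hij γ * M).1 j l = γ.1 1 0 * M.1 i l + γ.1 1 1 * M.1 j l := by
  rw [Submonoid.coe_mul, coe_embedPair, add_mul, one_mul, Matrix.add_apply, pairMatrix_mul_apply]
  simp [hij.symm]
  ring

theorem embedPair_mul_apply_of_ne {i j k : Fin d} (hij : i ≠ j) (γ : SU 2)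
    (M : SU d) (hi : k ≠ i) (hj : k ≠ j) (l : Fin d) :
    (embedPair hij γ * M).1 k l = M.1 k l := by
  rw [Submonoid.coe_mul, coe_embedPair, add_mul, one_mul, Matrix.add_apply, pairMatrix_mul_apply]
  simp [hi, hj]

/-- The quaternion with complex coordinates `a`, `b`. -/
noncomputable def quat (a b : ℂ) : Matrix (Fin 2) (Fin 2) ℂ := !![a, b; -conj b, conj a]

theorem quat_mul_star (a b : ℂ) :
    quat a b * star (quat a b) = ((‖a‖ ^ 2 + ‖b‖ ^ 2 : ℝ) : ℂ) • 1 := by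
  ext i j
  have ha := Complex.mul_conj' a
  have hb := Complex.mul_conj' b
  fin_cases i <;> fin_cases j <;>
    simp [quat, Matrix.mul_apply, Matrix.star_apply] <;> grind

theorem norm_quat_sq (a b : ℂ) : ‖quat a b‖ ^ 2 = ‖a‖ ^ 2 + ‖b‖ ^ 2 := by
  have h : ‖quat a b * star (quat a b)‖ = ‖quat a b‖ * ‖quat a b‖ := CStarRing.norm_self_mul_star
  rw [quat_mul_star, norm_smul, norm_one, mul_one, Complex.norm_real, Real.norm_of_nonneg
    (by positivity)] at h
  rw [sq, ← h]

theorem norm_quat_le (a b : ℂ) : ‖quat a b‖ ≤ ‖a‖ + ‖b‖ := by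
  refine abs_le_of_sq_le_sq' ?_ (by positivity) |>.2
  rw [norm_quat_sq]
  nlinarith [norm_nonneg a, norm_nonneg b]

/-- The element of `SU(2)` with complex coordinates `a`, `b`. -/
noncomputable def su2 (a b : ℂ) (h : ‖a‖ ^ 2 + ‖b‖ ^ 2 = 1) : SU 2 :=
  ⟨quat a b, by
    refine Matrix.mem_specialUnitaryGroup_iff.mpr ⟨?_, ?_⟩
    · rw [Matrix.mem_unitaryGroup_iff, quat_mul_star, h]
      simp
    · rw [quat, Matrix.det_fin_two_of, Complex.mul_conj', mul_neg, Complex.mul_conj', sub_neg_eq_add]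
      exact_mod_cast h⟩

theorem coe_su2 {a b : ℂ} (h : ‖a‖ ^ 2 + ‖b‖ ^ 2 = 1) : (su2 a b h).1 = quat a b := rfl

/-- For determinant one the adjoint, being the inverse, is the adjugate; this forces the quaternion
shape. -/
theorem exists_eq_su2 (γ : SU 2) : ∃ a b h, γ = su2 a b h := by
  obtain ⟨hu, hdet⟩ := Matrix.mem_specialUnitaryGroup_iff.mp γ.2
  rw [Matrix.mem_unitaryGroup_iff'] at hu
  have h1 : star γ.1 = γ.1.adjugate := by
    have h2 := Matrix.mul_adjugate γ.1
    rw [hdet, one_smul] at h2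
    calc star γ.1 = star γ.1 * (γ.1 * γ.1.adjugate) := by rw [h2, mul_one]
      _ = γ.1.adjugate := by rw [← mul_assoc, hu, one_mul]
  rw [Matrix.adjugate_fin_two] at h1
  have h00 := congr_fun (congr_fun h1 0) 0
  have h10 := congr_fun (congr_fun h1 1) 0
  simp [Matrix.star_apply] at h00 h10
  have hq : γ.1 = quat (γ.1 0 0) (γ.1 0 1) := by
    ext i j
    fin_cases i <;> fin_cases j <;> simp [quat, h00, h10]
  rw [hq, quat, Matrix.det_fin_two_of, Complex.mul_conj', mul_neg, Complex.mul_conj',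
    sub_neg_eq_add] at hdet
  exact ⟨γ.1 0 0, γ.1 0 1, by exact_mod_cast hdet, Subtype.ext hq⟩

theorem quat_sub_one (a b : ℂ) : quat a b - 1 = quat (a - 1) b := by
  ext i j
  fin_cases i <;> fin_cases j <;> simp [quat]

theorem dist_su2_one {a b : ℂ} (h : ‖a‖ ^ 2 + ‖b‖ ^ 2 = 1) :
    dist (su2 a b h) 1 = ‖quat (a - 1) b‖ := by
  rw [dist_eq_norm_coe, coe_su2, ← quat_sub_one]; rfl

theorem dist_le_two (g h : SU d) : dist g h ≤ 2 := by
  rw [dist_eq_norm_coe]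
  refine (norm_sub_le _ _).trans ?_
  linarith [norm_coe_le_one g, norm_coe_le_one h]

/-- A rotation in `SU(2)` taking a given vector to the first coordinate axis. -/
theorem exists_rotation (a b : ℂ) : ∃ (γ : SU 2) (r : ℝ), 0 ≤ r ∧
    γ.1 0 0 * a + γ.1 0 1 * b = r ∧ γ.1 1 0 * a + γ.1 1 1 * b = 0 ∧
    ∀ κ : ℝ, ‖a - 1‖ ≤ κ → ‖b‖ ≤ κ → dist γ 1 ≤ 8 * κ := by
  rcases eq_or_ne (‖a‖ ^ 2 + ‖b‖ ^ 2) 0 with h0 | h0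
  · have ha : a = 0 := by
      rw [← norm_eq_zero]; nlinarith [sq_nonneg ‖a‖, sq_nonneg ‖b‖]
    have hb : b = 0 := by
      rw [← norm_eq_zero]; nlinarith [sq_nonneg ‖a‖, sq_nonneg ‖b‖]
    refine ⟨1, 0, le_rfl, by simp [ha, hb], by simp [ha, hb], fun κ _ hκ => ?_⟩
    have := (norm_nonneg _).trans hκ
    simpa using this
  set r := Real.sqrt (‖a‖ ^ 2 + ‖b‖ ^ 2) with hr
  have hr2 : r ^ 2 = ‖a‖ ^ 2 + ‖b‖ ^ 2 := Real.sq_sqrt (by positivity)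
  have hr0 : 0 < r := Real.sqrt_pos.mpr (lt_of_le_of_ne (by positivity) h0.symm)
  have hrc : (r : ℂ) ≠ 0 := by exact_mod_cast hr0.ne'
  have hnorm : ‖conj a / r‖ ^ 2 + ‖conj b / r‖ ^ 2 = 1 := by
    rw [norm_div, norm_div, RCLike.norm_conj, RCLike.norm_conj, Complex.norm_real,
      Real.norm_of_nonneg hr0.le, div_pow, div_pow, ← add_div, ← hr2]
    exact div_self (by positivity)
  have hab : (r : ℂ) ^ 2 = conj a * a + conj b * b := by
    rw [Complex.conj_mul', Complex.conj_mul']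
    exact_mod_cast hr2
  refine ⟨su2 (conj a / r) (conj b / r) hnorm, r, hr0.le, ?_, ?_, fun κ ha hb => ?_⟩
  · simp only [coe_su2, quat, Matrix.of_apply, Matrix.cons_val', Matrix.cons_val_zero,
      Matrix.cons_val_one, Matrix.cons_val_fin_one]
    field_simp
    rw [hab]
  · simp [coe_su2, quat]
    field_simp
    ring
  -- For `κ ≥ 1/4` the diameter bound 2 suffices; otherwise `r` is bounded away from zero.
  · rcases le_or_gt (1 / 4) κ with hκ | hκ
    · exact (dist_le_two _ _).trans (by linarith)
    · have hκ0 := (norm_nonneg _).trans hb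
      have h1 : 1 - κ ≤ ‖a‖ := by
        have := norm_sub_norm_le (1 : ℂ) a
        rw [norm_one, norm_sub_rev] at this
        linarith
      have h2 : ‖a‖ ≤ 1 + κ := by
        have := norm_sub_norm_le a 1
        rw [norm_one] at this
        linarith
      have h3 : ‖a‖ ≤ r := abs_le_of_sq_le_sq' (by nlinarith [sq_nonneg ‖b‖]) hr0.le |>.2
      have h4 : r ≤ ‖a‖ + ‖b‖ := by
        refine abs_le_of_sq_le_sq' ?_ (by positivity) |>.2
        nlinarith [norm_nonneg a, norm_nonneg b]
      have h5 : ‖conj a / r - 1‖ = ‖a - r‖ / r := by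
        have : conj a / (r : ℂ) - 1 = conj (a - r) / r := by
          rw [map_sub, Complex.conj_ofReal]; field_simp
        rw [this, norm_div, RCLike.norm_conj, Complex.norm_real, Real.norm_of_nonneg hr0.le]
      have h6 : ‖a - r‖ ≤ 3 * κ := by
        have e : a - r = (a - 1) + ((1 - r : ℝ) : ℂ) := by push_cast; ring
        rw [e]
        refine (norm_add_le _ _).trans ?_
        have : ‖((1 - r : ℝ) : ℂ)‖ ≤ 2 * κ := by
          rw [Complex.norm_real, Real.norm_eq_abs, abs_le]
          constructor <;> linarith
        linarith
      rw [dist_su2_one]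
      refine (norm_quat_le _ _).trans ?_
      rw [h5, norm_div, RCLike.norm_conj, Complex.norm_real, Real.norm_of_nonneg hr0.le,
        ← add_div, div_le_iff₀ hr0]
      nlinarith

/-- `g` is a product of at most `n` embedded elements of `SU(2)` within `κ` of the identity. -/
def PairProd (n : ℕ) (κ : ℝ) (g : SU d) : Prop :=
  ∃ l : List (SU d), l.prod = g ∧ l.length ≤ n ∧
    ∀ x ∈ l, ∃ (i j : Fin d) (hij : i ≠ j) (γ : SU 2), x = embedPair hij γ ∧ dist γ 1 ≤ κ

theorem dist_inv_one (g : SU d) : dist g⁻¹ 1 = dist g 1 := by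
  refine le_antisymm ?_ ?_
  · simpa [dist_comm] using dist_mul_left_le 1 g g⁻¹
  · simpa [dist_comm] using dist_mul_left_le 1 g⁻¹ g

theorem PairProd.of_mul {n : ℕ} {κ : ℝ} {g : SU d} {i j : Fin d} {hij : i ≠ j} {γ : SU 2}
    (hγ : dist γ 1 ≤ κ) (h : PairProd n κ (embedPair hij γ * g)) : PairProd (n + 1) κ g := by
  obtain ⟨l, hl, hn, hx⟩ := h
  refine ⟨embedPair hij γ⁻¹ :: l, ?_, by simpa using hn, ?_⟩
  · rw [List.prod_cons, hl, ← mul_assoc]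
    have : embedPair hij γ⁻¹ * embedPair hij γ = 1 := by
      rw [← embedPairHom_apply, ← embedPairHom_apply, ← map_mul, inv_mul_cancel, map_one]
    rw [this, one_mul]
  · intro x hx'
    rcases List.mem_cons.mp hx' with rfl | h
    · exact ⟨i, j, hij, γ⁻¹, rfl, by rwa [dist_inv_one]⟩
    · exact hx x h

theorem norm_entry_le (A : Matrix (Fin d) (Fin d) ℂ) (i j : Fin d) : ‖A i j‖ ≤ ‖A‖ := by
  have h1 := Matrix.l2_opNorm_mulVec A (EuclideanSpace.single j (1 : ℂ))
  rw [PiLp.norm_single, norm_one, mul_one] at h1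
  refine le_trans ?_ h1
  have h2 := PiLp.norm_apply_le ((EuclideanSpace.equiv (Fin d) ℂ).symm
    (A *ᵥ (EuclideanSpace.single j (1 : ℂ)).ofLp)) i
  simpa using h2

/-- An upper triangular special unitary matrix whose diagonal entries except possibly the last
are nonnegative is the identity. -/
theorem eq_one_of_triangular (g : SU d) (hg : ∀ p q : Fin d, p < q → g.1 q p = 0)
    (hpos : ∀ p : Fin d, (p : ℕ) + 1 < d → ∃ r : ℝ, 0 ≤ r ∧ g.1 p p = r) : g = 1 := by
  obtain ⟨hu, hdet⟩ := Matrix.mem_specialUnitaryGroup_iff.mp g.2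
  have htri : g.1.BlockTriangular id := fun i j h => hg j i h
  rw [Matrix.mem_unitaryGroup_iff] at hu
  have hinv : g.1⁻¹ = star g.1 := Matrix.inv_eq_right_inv hu
  have : Invertible g.1 := invertibleOfRightInverse _ _ hu
  have hoff : ∀ p q : Fin d, p ≠ q → g.1 p q = 0 := by
    intro p q hpq
    rcases lt_or_gt_of_ne hpq with h | h
    · have h1 : (g.1⁻¹).BlockTriangular id := Matrix.blockTriangular_inv_of_blockTriangular htri
      rw [hinv] at h1
      have h2 := h1 (i := q) (j := p) h
      simpa [Matrix.star_apply] using h2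
    · exact hg q p h
  have hdiag : g.1 = Matrix.diagonal fun p => g.1 p p := by
    ext p q
    rcases eq_or_ne p q with rfl | h
    · simp
    · rw [Matrix.diagonal_apply_ne _ h, hoff p q h]
  have hone : ∀ p : Fin d, (p : ℕ) + 1 < d → g.1 p p = 1 := by
    intro p hp
    obtain ⟨r, hr, h⟩ := hpos p hp
    have h1 := congr_fun (congr_fun hu p) p
    rw [Matrix.mul_apply, Finset.sum_eq_single p (fun q _ hq => by rw [hoff p q hq.symm, zero_mul])
      (by simp), Matrix.star_apply, h] at h1
    simp only [RCLike.star_def, Complex.conj_ofReal, Matrix.one_apply_eq] at h1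
    have h2 : r * r = 1 := by exact_mod_cast h1
    have h3 : r = 1 := by nlinarith
    rw [h, h3]; simp
  have hall : ∀ p : Fin d, g.1 p p = 1 := by
    intro p
    by_cases hp : (p : ℕ) + 1 < d
    · exact hone p hp
    · rw [hdiag, Matrix.det_diagonal, Finset.prod_eq_single p] at hdet
      · exact hdet
      · intro q _ hq
        refine hone q ?_
        have := Fin.val_ne_of_ne hq
        omega
      · simp
  refine Subtype.ext ?_
  rw [hdiag]
  simp [hall]

/-- Givens elimination: every element of `SU(d)` is a product of at most `d²` embedded elements
of `SU(2)`, which are close to the identity if the given element is. -/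
theorem pairProd_of_dist_le (g : SU d) {ε : ℝ} (hε : dist g 1 ≤ ε) :
    PairProd (d * d) (8 * 9 ^ (d * d) * ε) g := by
  -- The counter `t = p·d + q` scans column `p`, row `q`; positions with `q ≤ p` are idle. A
  -- rotation in rows `p, q` clears entry `(q, p)`, keeps the earlier zeros and makes the diagonal
  -- entry `(p, p)` nonnegative, first at `q = p + 1`. It lies within `8ε` of the identity, so each
  -- step multiplies the distance by at most `9`.
  suffices H : ∀ n t : ℕ, t + n = d * d → ∀ g : SU d,
      (∀ p q : Fin d, p < q → (p : ℕ) * d + q < t → g.1 q p = 0) →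
      (∀ p : Fin d, (p : ℕ) + 1 < d → (p : ℕ) * d + p + 1 < t → ∃ r : ℝ, 0 ≤ r ∧ g.1 p p = r) →
      ∀ ε : ℝ, dist g 1 ≤ ε → PairProd n (8 * 9 ^ n * ε) g from
    H (d * d) 0 (by simp) g (by simp) (by simp) ε hε
  intro n
  induction n with
  | zero =>
    intro t ht g h1 h2 ε hε
    have hlt : ∀ p q : Fin d, (p : ℕ) * d + q < t := fun p q => by
      have hp := p.2
      have hq := q.2
      nlinarith
    have hg1 : g = 1 := eq_one_of_triangular g (fun p q h => h1 p q h (hlt p q)) fun p hp =>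
      h2 p hp (by simpa [add_assoc] using hlt p ⟨p + 1, hp⟩)
    exact ⟨[], by simp [hg1], by simp, by simp⟩
  | succ n ih =>
    intro t ht g h1 h2 ε hε
    have hε0 : 0 ≤ ε := dist_nonneg.trans hε
    have hd : 0 < d := by
      rcases d.eq_zero_or_pos with rfl | h
      · simp at ht
      · exact h
    have htd : t < d * d := by omega
    have hdm := Nat.div_add_mod t d
    obtain ⟨p, hp⟩ : ∃ p : Fin d, (p : ℕ) = t / d :=
      ⟨⟨t / d, Nat.div_lt_of_lt_mul htd⟩, rfl⟩
    obtain ⟨q, hq⟩ : ∃ q : Fin d, (q : ℕ) = t % d := ⟨⟨t % d, Nat.mod_lt _ hd⟩, rfl⟩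
    have htpq : t = (p : ℕ) * d + q := by rw [hp, hq, mul_comm]; exact hdm.symm
    have huniq : ∀ p' q' : Fin d, (p' : ℕ) * d + q' < t + 1 →
        (p' : ℕ) * d + q' < t ∨ (p' = p ∧ q' = q) := by
      intro p' q' h
      rcases Nat.lt_succ_iff_lt_or_eq.mp h with h | h
      · exact Or.inl h
      · right
        have e1 : (p' : ℕ) = t / d := by
          rw [← h, mul_comm, Nat.mul_add_div hd, Nat.div_eq_of_lt q'.2, add_zero]
        have e2 : (q' : ℕ) = t % d := by
          rw [← h, mul_comm, Nat.mul_add_mod, Nat.mod_eq_of_lt q'.2]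
        exact ⟨Fin.ext (e1.trans hp.symm), Fin.ext (e2.trans hq.symm)⟩
    by_cases hpq : p < q
    · obtain ⟨γ, r, hr, hγ1, hγ2, hγ⟩ := exists_rotation (g.1 p p) (g.1 q p)
      have hγε : dist γ 1 ≤ 8 * ε := by
        rw [dist_eq_norm_coe] at hε
        refine hγ ε ?_ ?_
        · have := norm_entry_le (g.1 - (1 : SU d).1) p p
          simp only [Matrix.sub_apply, OneMemClass.coe_one, Matrix.one_apply_eq] at this
          exact this.trans hε
        · have := norm_entry_le (g.1 - (1 : SU d).1) q p
          simp only [Matrix.sub_apply, OneMemClass.coe_one, Matrix.one_apply_ne hpq.ne',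
            sub_zero] at this
          exact this.trans hε
      have hg' : dist (embedPair hpq.ne γ * g) 1 ≤ 9 * ε := by
        have e1 := dist_triangle (embedPair hpq.ne γ * g) (1 * g) 1
        have e2 := dist_mul_right_le (embedPair hpq.ne γ) 1 g
        have e3 : dist (embedPair hpq.ne γ) 1 ≤ dist γ 1 := by
          have := dist_embedPair_le hpq.ne γ 1
          rwa [← embedPairHom_apply hpq.ne 1, map_one] at this
        rw [one_mul] at e1 e2
        linarith
      have key := ih (t + 1) (by omega) (embedPair hpq.ne γ * g) ?_ ?_ (9 * ε) hg'
      · refine PairProd.of_mul (hij := hpq.ne) (γ := γ) ?_ ?_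
        · refine hγε.trans ?_
          have : (1 : ℝ) ≤ 9 ^ (n + 1) := one_le_pow₀ (by norm_num)
          nlinarith
        · convert key using 1
          rw [pow_succ]; ring
      · intro p' q' hlt hlt'
        have hzero : ∀ k : Fin d, (p' : ℕ) < k → (k : ℕ) < q ∨ (p' : ℕ) < p →
            ((p' : ℕ) ≤ p) → g.1 k p' = 0 := by
          intro k hk hk' hk''
          refine h1 p' k hk ?_
          rw [htpq]
          rcases hk' with hk' | hk'
          · nlinarith
          · have := k.2
            nlinarith
        have hple : (p' : ℕ) ≤ p := by
          rw [hp]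
          have e : (p' : ℕ) * d ≤ t := by omega
          exact (Nat.le_div_iff_mul_le hd).mpr e
        rcases huniq p' q' hlt' with h | ⟨rfl, rfl⟩
        · rcases hple.lt_or_eq with hlt2 | heq
          · have ep : g.1 p p' = 0 := hzero p hlt2 (Or.inr hlt2) hple
            have eq : g.1 q p' = 0 := hzero q (hlt2.trans hpq) (Or.inr hlt2) hple
            by_cases hqp : q' = p
            · rw [hqp, embedPair_mul_apply_left, ep, eq]; simp
            by_cases hqq : q' = q
            · rw [hqq, embedPair_mul_apply_right, ep, eq]; simp
            · rw [embedPair_mul_apply_of_ne _ _ _ hqp hqq]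
              exact h1 p' q' hlt h
          · have hpp : p' = p := Fin.ext heq
            subst hpp
            have hne : q' ≠ q := by
              rintro rfl
              omega
            rw [embedPair_mul_apply_of_ne _ _ _ hlt.ne' hne]
            exact h1 p' q' hlt h
        · rw [embedPair_mul_apply_right, hγ2]
      · intro p' hp' hlt'
        have hlt'' : (p' : ℕ) * d + (⟨p' + 1, hp'⟩ : Fin d) < t + 1 := by
          simpa [add_assoc] using hlt'
        by_cases hpp : p' = p
        · subst hpp
          exact ⟨r, hr, by rw [embedPair_mul_apply_left, hγ1]⟩
        · rcases huniq p' ⟨p' + 1, hp'⟩ hlt'' with h | ⟨rfl, -⟩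
          · have hple : (p' : ℕ) ≤ p := by
              rw [hp]
              have e : (p' : ℕ) * d ≤ t := by omega
              exact (Nat.le_div_iff_mul_le hd).mpr e
            have hlt2 : p' < p := lt_of_le_of_ne hple hpp
            rw [embedPair_mul_apply_of_ne _ _ _ hpp (hlt2.trans hpq).ne]
            exact h2 p' hp' (by simpa [add_assoc] using h)
          · exact absurd rfl hpp
    · have key := ih (t + 1) (by omega) g ?_ ?_ ε hε
      · obtain ⟨l, hl, hn, hx⟩ := key
        refine ⟨l, hl, hn.trans (Nat.le_succ n), fun x hxl => ?_⟩
        obtain ⟨i, j, hij, γ, h, h'⟩ := hx x hxl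
        refine ⟨i, j, hij, γ, h, h'.trans ?_⟩
        have : (9 : ℝ) ^ n ≤ 9 ^ (n + 1) := pow_le_pow_right₀ (by norm_num) (Nat.le_succ n)
        gcongr
      · intro p' q' hlt hlt'
        rcases huniq p' q' hlt' with h | ⟨rfl, rfl⟩
        · exact h1 p' q' hlt h
        · exact absurd hlt hpq
      · intro p' hp' hlt'
        rcases huniq p' ⟨p' + 1, hp'⟩ (by simpa [add_assoc] using hlt') with h | ⟨h, h'⟩
        · exact h2 p' hp' (by simpa [add_assoc] using h)
        · refine absurd ?_ hpq
          rw [← h, ← h', Fin.lt_def]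
          exact Nat.lt_succ_self _

end Givens

/-! ### Commutators in `SU(2)` and the Solovay–Kitaev iteration -/

section Commutators

open ComplexConjugate
open scoped commutatorElement

theorem quat_mul (a b a' b' : ℂ) :
    quat a b * quat a' b' = quat (a * a' - b * conj b') (a * b' + b * conj a') := by
  ext i j
  fin_cases i <;> fin_cases j <;> simp [quat, Matrix.mul_apply] <;> ring

theorem commutatorElement_eq_of_mul_eq {G : Type*} [Group G] {a b c : G}
    (h : a * b = c * (b * a)) : ⁅a, b⁆ = c := by
  rw [commutatorElement_def, h]; group

/-- `SU(2)` is perfect. -/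
theorem subgroup_eq_top_of_commutators {N : Subgroup (SU 2)} (hN : ∀ a b : SU 2, ⁅a, b⁆ ∈ N) :
    N = ⊤ := by
  have hE : ∀ θ : ℝ, ‖Complex.exp (θ * Complex.I)‖ ^ 2 + ‖(0 : ℂ)‖ ^ 2 = 1 := fun θ => by
    rw [Complex.norm_exp_ofReal_mul_I]; simp
  have hR : ∀ θ : ℝ, ‖(Real.cos θ : ℂ)‖ ^ 2 + ‖(Real.sin θ : ℂ)‖ ^ 2 = 1 := fun θ => by
    rw [Complex.norm_real, Complex.norm_real, Real.norm_eq_abs, Real.norm_eq_abs, sq_abs, sq_abs]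
    exact Real.cos_sq_add_sin_sq θ
  have hconj : ∀ θ : ℝ, conj (Complex.exp (θ * Complex.I)) = Complex.exp (-(θ * Complex.I)) :=
    fun θ => by rw [← Complex.exp_conj]; simp
  -- Conjugation by the quaternion `j` inverts the diagonal torus, so the commutator with `j`
  -- doubles the angle. The next claim does the same for real rotations, which the quaternion `i`
  -- inverts.
  have hEN : ∀ θ : ℝ, su2 _ _ (hE θ) ∈ N := fun θ => by
    have h : ⁅su2 _ _ (hE (θ / 2)), su2 0 1 (by simp)⁆ = su2 _ _ (hE θ) := by
      refine commutatorElement_eq_of_mul_eq (Subtype.ext ?_)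
      rw [Submonoid.coe_mul, Submonoid.coe_mul, Submonoid.coe_mul]
      simp only [coe_su2, quat_mul, hconj]
      simp only [mul_zero, mul_one, zero_mul, map_one, map_zero, sub_zero, zero_add, add_zero]
      congr 1
      rw [one_mul, ← Complex.exp_add]
      congr 1
      push_cast
      ring
    exact h ▸ hN _ _
  have hRN : ∀ θ : ℝ, su2 _ _ (hR θ) ∈ N := fun θ => by
    have h : ⁅su2 _ _ (hR (θ / 2)), su2 Complex.I 0 (by simp)⁆ = su2 _ _ (hR θ) := by
      refine commutatorElement_eq_of_mul_eq (Subtype.ext ?_)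
      rw [Submonoid.coe_mul, Submonoid.coe_mul, Submonoid.coe_mul]
      simp only [coe_su2, quat_mul]
      have hθ : θ = θ / 2 + θ / 2 := by ring
      have h1 : Real.cos θ = Real.cos (θ / 2) ^ 2 - Real.sin (θ / 2) ^ 2 := by
        rw [hθ, Real.cos_add]; ring_nf
      have h2 : Real.sin θ = 2 * Real.sin (θ / 2) * Real.cos (θ / 2) := by
        rw [← Real.sin_two_mul]; ring_nf
      have h3 : (Real.cos (θ / 2) : ℂ) ^ 2 + (Real.sin (θ / 2) : ℂ) ^ 2 = 1 := by
        exact_mod_cast Real.cos_sq_add_sin_sq (θ / 2)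
      rw [h1, h2]
      simp only [mul_zero, zero_mul, map_zero, sub_zero, zero_add, add_zero,
        Complex.conj_I, Complex.conj_ofReal, map_mul]
      congr 1
      · push_cast [-Complex.ofReal_cos, -Complex.ofReal_sin]
        linear_combination (-Complex.I * (Real.cos (θ / 2) : ℂ)) * h3
      · push_cast [-Complex.ofReal_cos, -Complex.ofReal_sin]
        linear_combination (Complex.I * (Real.sin (θ / 2) : ℂ)) * h3
    exact h ▸ hN _ _
  rw [eq_top_iff]
  intro γ _
  obtain ⟨a, b, h, rfl⟩ := exists_eq_su2 γ
  have hcos : Real.cos (Real.arccos ‖a‖) = ‖a‖ :=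
    Real.cos_arccos (by linarith [norm_nonneg a])
      (by nlinarith [norm_nonneg a, sq_nonneg ‖b‖])
  have hsin : Real.sin (Real.arccos ‖a‖) = ‖b‖ := by
    rw [Real.sin_arccos, show 1 - ‖a‖ ^ 2 = ‖b‖ ^ 2 by linarith, Real.sqrt_sq (norm_nonneg b)]
  -- Euler angles: diagonal, real rotation, diagonal.
  have key : su2 a b h = su2 _ _ (hE ((a.arg + b.arg) / 2)) * su2 _ _ (hR (Real.arccos ‖a‖)) *
      su2 _ _ (hE ((a.arg - b.arg) / 2)) := by
    refine Subtype.ext ?_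
    rw [Submonoid.coe_mul, Submonoid.coe_mul]
    simp only [coe_su2, quat_mul, hconj]
    rw [hcos, hsin]
    simp only [mul_zero, zero_mul, map_zero, sub_zero, zero_add, add_zero, Complex.conj_ofReal]
    congr 1
    · conv_lhs => rw [← Complex.norm_mul_exp_arg_mul_I a]
      rw [mul_comm, mul_right_comm, ← Complex.exp_add]
      congr 2
      push_cast; ring
    · conv_lhs => rw [← Complex.norm_mul_exp_arg_mul_I b]
      rw [mul_comm, mul_right_comm, ← Complex.exp_add]
      congr 2
      push_cast; ring
  rw [key]
  exact N.mul_mem (N.mul_mem (hEN _) (hRN _)) (hEN _)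

/-- The hypothesis on `α` makes `quat α β` a purely imaginary unit quaternion, of square `-1`, so
`√(1-t²) + t·quat α β` is again a unit quaternion. -/
theorem exists_eq_rotation {α β : ℂ} (hα : α.re = 0) (h : ‖α‖ ^ 2 + ‖β‖ ^ 2 = 1) {t : ℝ}
    (ht : |t| ≤ 1) : ∃ a : SU 2, a.1 = (Real.sqrt (1 - t ^ 2) : ℂ) • 1 + (t : ℂ) • quat α β := by
  have ht2 : t ^ 2 ≤ 1 := by rw [← sq_abs]; nlinarith [abs_nonneg t]
  set s := Real.sqrt (1 - t ^ 2)
  have hs : s ^ 2 = 1 - t ^ 2 := Real.sq_sqrt (by linarith)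
  refine ⟨su2 (s + t * α) (t * β) ?_, ?_⟩
  · have h1 : ‖(s : ℂ) + t * α‖ ^ 2 = s ^ 2 + t ^ 2 * ‖α‖ ^ 2 := by
      rw [Complex.sq_norm, Complex.sq_norm, Complex.normSq_apply, Complex.normSq_apply]
      simp [hα]
      ring
    rw [h1, norm_mul, Complex.norm_real, mul_pow, Real.norm_eq_abs, sq_abs, hs]
    linear_combination t ^ 2 * h
  · rw [coe_su2]
    ext i j
    fin_cases i <;> fin_cases j <;> simp [quat]

variable {d : ℕ}

/-- The bracket `ab - ba` is unchanged when `1` is subtracted from `a` and `b`, so this form shows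
that the commutator is bilinearly small. -/
theorem coe_commutator_sub_one (a b : SU d) :
    (⁅a, b⁆ : SU d).1 - 1 = (a.1 * b.1 - b.1 * a.1) * (a⁻¹ * b⁻¹ : SU d).1 := by
  have h1 : (⁅a, b⁆ : SU d).1 = a.1 * b.1 * (a⁻¹ * b⁻¹ : SU d).1 := by
    rw [commutatorElement_def, mul_assoc, mul_assoc, ← mul_assoc, Submonoid.coe_mul,
      Submonoid.coe_mul]
  have h2 : b.1 * a.1 * (a⁻¹ * b⁻¹ : SU d).1 = 1 := by
    rw [← Submonoid.coe_mul, ← Submonoid.coe_mul, mul_assoc, ← mul_assoc a, mul_inv_cancel, one_mul,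
      mul_inv_cancel]
    rfl
  rw [sub_mul, h2, h1]

theorem dist_mul_mul_le (a b a' b' : SU d) : dist (a * b) (a' * b') ≤ dist a a' + dist b b' :=
  (dist_triangle _ (a' * b) _).trans
    (add_le_add (dist_mul_right_le a a' b) (dist_mul_left_le b b' a'))

theorem dist_inv_inv_le (a b : SU d) : dist a⁻¹ b⁻¹ ≤ dist a b := by
  have h1 := dist_mul_left_le (a⁻¹ * b) 1 b⁻¹
  have h2 := dist_mul_left_le b a a⁻¹
  have h3 := dist_mul_right_le (a⁻¹ * b) 1 b⁻¹
  simp only [inv_mul_cancel, one_mul, mul_assoc, mul_inv_cancel, mul_one] at h2 h3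
  rw [dist_comm a b]
  exact h3.trans h2

theorem norm_mul_sub_mul_le (x y : Matrix (Fin d) (Fin d) ℂ) :
    ‖x * y - y * x‖ ≤ 2 * (‖x‖ * ‖y‖) := by
  refine (norm_sub_le _ _).trans ?_
  have h1 := norm_mul_le x y
  have h2 := norm_mul_le y x
  linarith

/-- Commutators of elements near the identity depend on them with quadratic accuracy. -/
theorem dist_commutator_le {a b a' b' : SU d} {τ : ℝ} (hτ : 0 ≤ τ) (haa : dist a a' ≤ τ ^ 2)
    (hbb : dist b b' ≤ τ ^ 2) (ha : dist a 1 ≤ 2 * τ) (hb : dist b 1 ≤ 2 * τ) :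
    dist ⁅a, b⁆ ⁅a', b'⁆ ≤ 50 * τ ^ 3 := by
  rcases le_or_gt 1 τ with h1 | h1
  · have : 1 ≤ τ ^ 3 := one_le_pow₀ h1
    exact (dist_le_two _ _).trans (by linarith)
  have hu : dist (a⁻¹ * b⁻¹) (a'⁻¹ * b'⁻¹) ≤ 2 * τ ^ 2 := by
    have h2 := dist_mul_mul_le a⁻¹ b⁻¹ a'⁻¹ b'⁻¹
    have h3 := dist_inv_inv_le a a'
    have h4 := dist_inv_inv_le b b'
    linarith
  have ha' : dist a' 1 ≤ 3 * τ := by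
    have := dist_triangle_left a' 1 a
    nlinarith
  have hb' : dist b' 1 ≤ 3 * τ := by
    have := dist_triangle_left b' 1 b
    nlinarith
  have hn := norm_coe_le_one (a⁻¹ * b⁻¹)
  rw [dist_eq_norm_coe] at haa hbb ha hb ha' hb' hu ⊢
  set u := (a⁻¹ * b⁻¹ : SU d).1 with hudef
  set u' := (a'⁻¹ * b'⁻¹ : SU d).1 with hudef'
  have e1 : (⁅a, b⁆ : SU d).1 - (⁅a', b'⁆ : SU d).1 =
      ((⁅a, b⁆ : SU d).1 - 1) - ((⁅a', b'⁆ : SU d).1 - 1) := by abel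
  rw [e1, coe_commutator_sub_one, coe_commutator_sub_one, ← hudef, ← hudef']
  rw [OneMemClass.coe_one] at ha hb ha' hb'
  set x := a.1 - 1 with hx
  set y := b.1 - 1 with hy
  set x' := a'.1 - 1 with hx'
  set y' := b'.1 - 1 with hy'
  have e2 : a.1 * b.1 - b.1 * a.1 = x * y - y * x := by rw [hx, hy]; noncomm_ring
  have e3 : a'.1 * b'.1 - b'.1 * a'.1 = x' * y' - y' * x' := by rw [hx', hy']; noncomm_ring
  rw [show a.1 - a'.1 = x - x' by rw [hx, hx']; abel] at haa
  rw [show b.1 - b'.1 = y - y' by rw [hy, hy']; abel] at hbb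
  -- Telescoping: each term has one factor of size `τ²` and at least one more factor of size `τ`.
  have e4 : (x * y - y * x) * u - (x' * y' - y' * x') * u' =
      (((x - x') * y - y * (x - x')) + (x' * (y - y') - (y - y') * x')) * u +
        (x' * y' - y' * x') * (u - u') := by noncomm_ring
  rw [e2, e3, e4]
  have n1 := norm_mul_sub_mul_le (x - x') y
  have n2 := norm_mul_sub_mul_le x' (y - y')
  have n3 := norm_mul_sub_mul_le x' y'
  have m1 : ‖x - x'‖ * ‖y‖ ≤ τ ^ 2 * (2 * τ) := by gcongr
  have m2 : ‖x'‖ * ‖y - y'‖ ≤ 3 * τ * τ ^ 2 := by gcongr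
  have m3 : ‖x'‖ * ‖y'‖ ≤ 3 * τ * (3 * τ) := by gcongr
  calc _ ≤ ‖((x - x') * y - y * (x - x')) + (x' * (y - y') - (y - y') * x')‖ * ‖u‖ +
        ‖x' * y' - y' * x'‖ * ‖u - u'‖ := (norm_add_le _ _).trans
          (add_le_add (norm_mul_le _ _) (norm_mul_le _ _))
    _ ≤ (4 * τ ^ 3 + 6 * τ ^ 3) * 1 + 18 * τ ^ 2 * (2 * τ ^ 2) := by
      gcongr
      · refine (norm_add_le _ _).trans ?_
        nlinarith
      · nlinarith
    _ ≤ 50 * τ ^ 3 := by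
      have : τ ^ 4 ≤ τ ^ 3 := pow_le_pow_of_le_one hτ h1.le (by norm_num)
      nlinarith

/-- A small step along one quaternion axis is a commutator of steps along the other two, up to an
error of third order. -/
theorem exists_commutator_near {α β α' β' : ℂ} (hα : α.re = 0) (h : ‖α‖ ^ 2 + ‖β‖ ^ 2 = 1)
    (hα' : α'.re = 0) (h' : ‖α'‖ ^ 2 + ‖β'‖ ^ 2 = 1) {Z : Matrix (Fin 2) (Fin 2) ℂ}
    (hZ : quat α β * quat α' β' - quat α' β' * quat α β = (2 : ℂ) • Z) {t z : ℝ}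
    (ht0 : 0 ≤ t) (ht : t ≤ 1) (hz : |z| ≤ t ^ 2) :
    ∃ a b : SU 2, dist a 1 ≤ 2 * t ∧ dist b 1 ≤ 2 * t ∧
      ‖(⁅a, b⁆ : SU 2).1 - 1 - (z : ℂ) • Z‖ ≤ 8 * t ^ 3 := by
  -- Exchanging the two axes changes the sign of the bracket.
  wlog hz0 : 0 ≤ z generalizing z α β α' β' Z
  · obtain ⟨a, b, ha, hb, hab⟩ := this (α := α') (β := β') (α' := α) (β' := β) (z := -z)
      (Z := -Z) hα' h' hα h (by rw [smul_neg, ← hZ]; abel) (by rwa [abs_neg]) (by linarith)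
    refine ⟨a, b, ha, hb, ?_⟩
    simpa using hab
  rw [abs_of_nonneg hz0] at hz
  -- The bracket of `s + τX` and `s + τY` is `τ²(XY - YX) = 2τ²Z`, which equals `zZ` for this `τ`.
  set τ := Real.sqrt (z / 2) with hτ
  have hτ2 : τ ^ 2 = z / 2 := Real.sq_sqrt (by linarith)
  have hτ0 : 0 ≤ τ := Real.sqrt_nonneg _
  have hτt : τ ≤ t := abs_le_of_sq_le_sq' (by linarith) ht0 |>.2
  have hτ1 : |τ| ≤ 1 := by rw [abs_of_nonneg hτ0]; linarith
  have hnq : ∀ {α β : ℂ}, ‖α‖ ^ 2 + ‖β‖ ^ 2 = 1 → ‖quat α β‖ = 1 := fun {α β} h => by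
    rw [← sq_eq_sq₀ (norm_nonneg _) zero_le_one, norm_quat_sq, h]; norm_num
  have hX := hnq h
  have hY := hnq h'
  obtain ⟨a, ha⟩ := exists_eq_rotation hα h hτ1
  obtain ⟨b, hb⟩ := exists_eq_rotation hα' h' hτ1
  set s := Real.sqrt (1 - τ ^ 2) with hs
  have hs1 : |s - 1| ≤ τ := by
    have hs0 : 0 ≤ s := Real.sqrt_nonneg _
    have hs2 : s ^ 2 = 1 - τ ^ 2 := Real.sq_sqrt (by nlinarith)
    rw [abs_le]
    constructor <;> nlinarith
  have hdist : ∀ {c : SU 2} {X : Matrix (Fin 2) (Fin 2) ℂ}, ‖X‖ = 1 →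
      c.1 = (s : ℂ) • 1 + (τ : ℂ) • X → dist c 1 ≤ 2 * t := fun {c X} hX hc => by
    have e : c.1 - 1 = ((s - 1 : ℝ) : ℂ) • 1 + (τ : ℂ) • X := by
      rw [hc]; push_cast; rw [sub_smul, one_smul]; abel
    rw [dist_eq_norm_coe, OneMemClass.coe_one, e]
    refine (norm_add_le _ _).trans ?_
    rw [norm_smul, norm_smul, hX, norm_one, Complex.norm_real, Complex.norm_real,
      Real.norm_eq_abs, Real.norm_eq_abs, abs_of_nonneg hτ0]
    linarith
  have hda := hdist hX ha
  have hdb := hdist hY hb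
  refine ⟨a, b, hda, hdb, ?_⟩
  have hcomm : a.1 * b.1 - b.1 * a.1 = (z : ℂ) • Z := by
    have : a.1 * b.1 - b.1 * a.1 =
        ((τ : ℂ) ^ 2) • (quat α β * quat α' β' - quat α' β' * quat α β) := by
      rw [ha, hb]
      simp only [add_mul, mul_add, smul_mul_assoc, mul_smul_comm, one_mul, mul_one]
      module
    rw [this, hZ, smul_smul]
    congr 1
    have : ((τ ^ 2 : ℝ) : ℂ) = ((z / 2 : ℝ) : ℂ) := by rw [hτ2]
    push_cast at this
    rw [this]; ring
  have hzZ : ‖(z : ℂ) • Z‖ ≤ t ^ 2 := by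
    have h2Z : ‖(2 : ℂ) • Z‖ ≤ 2 * (1 * 1) := by
      rw [← hZ]
      have := norm_mul_sub_mul_le (quat α β) (quat α' β')
      rwa [hX, hY] at this
    rw [norm_smul] at h2Z ⊢
    rw [Complex.norm_real, Real.norm_of_nonneg hz0]
    norm_num at h2Z
    nlinarith [norm_nonneg Z]
  rw [coe_commutator_sub_one, hcomm]
  have hu : dist (a⁻¹ * b⁻¹) 1 ≤ 4 * t := by
    have h1 := dist_mul_mul_le a⁻¹ b⁻¹ 1 1
    rw [dist_inv_one, dist_inv_one, mul_one] at h1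
    linarith
  rw [dist_eq_norm_coe, OneMemClass.coe_one] at hu
  set u := (a⁻¹ * b⁻¹ : SU 2).1
  calc ‖(z : ℂ) • Z * u - (z : ℂ) • Z‖ = ‖(z : ℂ) • Z * (u - 1)‖ := by rw [mul_sub, mul_one]
    _ ≤ t ^ 2 * (4 * t) := (norm_mul_le _ _).trans (by gcongr)
    _ ≤ 8 * t ^ 3 := by nlinarith [pow_nonneg ht0 3]

/-- Elements of `SU(2)` near the identity are products of three commutators of elements at square
root distance, up to an error of third order. -/
theorem exists_commutators_near (γ : SU 2) {t : ℝ} (ht0 : 0 ≤ t) (hγ : dist γ 1 ≤ t ^ 2) :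
    ∃ a b a' b' a'' b'' : SU 2, (dist a 1 ≤ 2 * t ∧ dist b 1 ≤ 2 * t) ∧
      (dist a' 1 ≤ 2 * t ∧ dist b' 1 ≤ 2 * t) ∧ (dist a'' 1 ≤ 2 * t ∧ dist b'' 1 ≤ 2 * t) ∧
      dist γ (⁅a, b⁆ * ⁅a', b'⁆ * ⁅a'', b''⁆) ≤ 1000 * t ^ 3 := by
  rcases le_or_gt 1 t with h1 | h1
  · have : 1 ≤ t ^ 3 := one_le_pow₀ h1
    refine ⟨1, 1, 1, 1, 1, 1, ?_, ?_, ?_, (dist_le_two _ _).trans (by linarith)⟩ <;>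
      simp [ht0]
  obtain ⟨p, q, hpq, rfl⟩ := exists_eq_su2 γ
  rw [dist_su2_one] at hγ
  have hsq : ‖p - 1‖ ^ 2 + ‖q‖ ^ 2 ≤ (t ^ 2) ^ 2 := by
    rw [← norm_quat_sq]; gcongr
  have ep : ‖p - 1‖ ^ 2 = (p.re - 1) ^ 2 + p.im ^ 2 := by
    rw [Complex.sq_norm, Complex.normSq_apply]; simp; ring
  have eq : ‖q‖ ^ 2 = q.re ^ 2 + q.im ^ 2 := by
    rw [Complex.sq_norm, Complex.normSq_apply]; ring
  have ep' : ‖p‖ ^ 2 = p.re ^ 2 + p.im ^ 2 := by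
    rw [Complex.sq_norm, Complex.normSq_apply]; ring
  have ht2 : 0 ≤ t ^ 2 := sq_nonneg t
  have s1 := sq_nonneg (p.re - 1)
  have s2 := sq_nonneg p.im
  have s3 := sq_nonneg q.re
  have s4 := sq_nonneg q.im
  have hx : |p.im| ≤ t ^ 2 := abs_le_of_sq_le_sq (by linarith) ht2
  have hy : |q.re| ≤ t ^ 2 := abs_le_of_sq_le_sq (by linarith) ht2
  have hz : |q.im| ≤ t ^ 2 := abs_le_of_sq_le_sq (by linarith) ht2
  have t43 : t ^ 4 ≤ t ^ 3 := pow_le_pow_of_le_one ht0 h1.le (by norm_num)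
  have t63 : t ^ 6 ≤ t ^ 3 := pow_le_pow_of_le_one ht0 h1.le (by norm_num)
  have t32 : t ^ 3 ≤ t ^ 2 := pow_le_pow_of_le_one ht0 h1.le (by norm_num)
  have t30 : 0 ≤ t ^ 3 := pow_nonneg ht0 3
  -- On the unit sphere `2(1 - Re p) = ‖p-1‖² + ‖q‖² ≤ t⁴`, so the real part needs no correction;
  -- the three imaginary coordinates get one commutator each.
  have hw : |p.re - 1| ≤ t ^ 3 := by
    rw [abs_le]
    constructor <;> nlinarith
  have hI : Complex.I.re = 0 := Complex.I_re
  have hJ : (0 : ℂ).re = 0 := Complex.zero_re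
  have nI : ‖Complex.I‖ ^ 2 + ‖(0 : ℂ)‖ ^ 2 = 1 := by simp
  have nJ : ‖(0 : ℂ)‖ ^ 2 + ‖(1 : ℂ)‖ ^ 2 = 1 := by simp
  have nK : ‖(0 : ℂ)‖ ^ 2 + ‖Complex.I‖ ^ 2 = 1 := by simp
  obtain ⟨a, b, ha, hb, hab⟩ := exists_commutator_near hJ nJ hJ nK (Z := quat Complex.I 0) (by
    ext i j; fin_cases i <;> fin_cases j <;> simp [quat] <;> ring) ht0 h1.le hx
  obtain ⟨a', b', ha', hb', hab'⟩ := exists_commutator_near hJ nK hI nI (Z := quat 0 1) (by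
    ext i j; fin_cases i <;> fin_cases j <;> simp [quat] <;> ring) ht0 h1.le hy
  obtain ⟨a'', b'', ha'', hb'', hab''⟩ := exists_commutator_near hI nI hJ nJ
    (Z := quat 0 Complex.I) (by
    ext i j; fin_cases i <;> fin_cases j <;> simp [quat] <;> ring) ht0 h1.le hz
  refine ⟨a, b, a', b', a'', b'', ⟨ha, hb⟩, ⟨ha', hb'⟩, ⟨ha'', hb''⟩, ?_⟩
  have hnq : ∀ {α β : ℂ}, ‖α‖ ^ 2 + ‖β‖ ^ 2 = 1 → ‖quat α β‖ = 1 := fun {α β} h => by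
    rw [← sq_eq_sq₀ (norm_nonneg _) zero_le_one, norm_quat_sq, h]; norm_num
  have hbound : ∀ {c : SU 2} {x : ℝ} {X : Matrix (Fin 2) (Fin 2) ℂ}, ‖X‖ = 1 → |x| ≤ t ^ 2 →
      ‖c.1 - 1 - (x : ℂ) • X‖ ≤ 8 * t ^ 3 → ‖c.1 - 1‖ ≤ 9 * t ^ 2 := fun {c x X} hX hx hc => by
    have := norm_add_le (c.1 - 1 - (x : ℂ) • X) ((x : ℂ) • X)
    rw [sub_add_cancel, norm_smul, hX, Complex.norm_real, Real.norm_eq_abs] at this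
    linarith
  have n1 := hbound (hnq nI) hx hab
  have n2 := hbound (hnq nJ) hy hab'
  have n3 := hbound (hnq nK) hz hab''
  rw [dist_eq_norm_coe, Submonoid.coe_mul, Submonoid.coe_mul, coe_su2, ← norm_neg, neg_sub]
  set P := (⁅a, b⁆ : SU 2).1 - 1 with hP
  set Q := (⁅a', b'⁆ : SU 2).1 - 1 with hQ
  set R := (⁅a'', b''⁆ : SU 2).1 - 1 with hR
  have hquat : quat p q = 1 + ((p.re - 1 : ℝ) : ℂ) • 1 + (p.im : ℂ) • quat Complex.I 0 +
      (q.re : ℂ) • quat 0 1 + (q.im : ℂ) • quat 0 Complex.I := by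
    ext i j
    fin_cases i <;> fin_cases j <;> apply Complex.ext <;> simp [quat]
  have e : (⁅a, b⁆ : SU 2).1 * (⁅a', b'⁆ : SU 2).1 * (⁅a'', b''⁆ : SU 2).1 - quat p q =
      (P - (p.im : ℂ) • quat Complex.I 0) + (Q - (q.re : ℂ) • quat 0 1) +
        (R - (q.im : ℂ) • quat 0 Complex.I) + (P * Q + P * R + Q * R + P * Q * R) -
        ((p.re - 1 : ℝ) : ℂ) • 1 := by
    rw [hquat, show (⁅a, b⁆ : SU 2).1 = 1 + P by rw [hP]; abel,
      show (⁅a', b'⁆ : SU 2).1 = 1 + Q by rw [hQ]; abel,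
      show (⁅a'', b''⁆ : SU 2).1 = 1 + R by rw [hR]; abel]
    noncomm_ring
  have hone : ‖((p.re - 1 : ℝ) : ℂ) • (1 : Matrix (Fin 2) (Fin 2) ℂ)‖ ≤ t ^ 3 := by
    rw [norm_smul, norm_one, mul_one, Complex.norm_real]; exact hw
  have m1 : ‖P * Q‖ ≤ 81 * t ^ 4 := (norm_mul_le _ _).trans (by
    calc ‖P‖ * ‖Q‖ ≤ 9 * t ^ 2 * (9 * t ^ 2) := by gcongr
      _ = _ := by ring)
  have m2 : ‖P * R‖ ≤ 81 * t ^ 4 := (norm_mul_le _ _).trans (by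
    calc ‖P‖ * ‖R‖ ≤ 9 * t ^ 2 * (9 * t ^ 2) := by gcongr
      _ = _ := by ring)
  have m3 : ‖Q * R‖ ≤ 81 * t ^ 4 := (norm_mul_le _ _).trans (by
    calc ‖Q‖ * ‖R‖ ≤ 9 * t ^ 2 * (9 * t ^ 2) := by gcongr
      _ = _ := by ring)
  have m4 : ‖P * Q * R‖ ≤ 729 * t ^ 6 := (norm_mul_le _ _).trans (by
    calc ‖P * Q‖ * ‖R‖ ≤ 81 * t ^ 4 * (9 * t ^ 2) := by gcongr
      _ = _ := by ring)
  rw [e]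
  refine (norm_sub_le _ _).trans ?_
  have k1 := norm_add₃_le (a := P - (p.im : ℂ) • quat Complex.I 0)
    (b := Q - (q.re : ℂ) • quat 0 1) (c := R - (q.im : ℂ) • quat 0 Complex.I)
  have k2 := norm_add₄_le (a := P * Q) (b := P * R) (c := Q * R) (d := P * Q * R)
  have k3 := norm_add_le ((P - (p.im : ℂ) • quat Complex.I 0) + (Q - (q.re : ℂ) • quat 0 1) +
        (R - (q.im : ℂ) • quat 0 Complex.I)) (P * Q + P * R + Q * R + P * Q * R)
  linarith

end Commutators

section SolovayKitaev

open scoped commutatorElement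

variable {d : ℕ}

/-- One step of the Solovay–Kitaev iteration. -/
theorem exists_solovayKitaev_step (d : ℕ) : ∃ C K : ℝ, 1 ≤ C ∧ 1 ≤ K ∧
    ∀ ρ : SU d → ℝ, IsLength ρ → ∀ t r : ℝ, 0 ≤ t →
      (∀ g, ∃ g', dist g g' ≤ t ^ 2 ∧ ρ g' ≤ r) →
      ∀ g, ∃ g', dist g g' ≤ C * t ^ 3 ∧ ρ g' ≤ K * r := by
  set B : ℝ := 8 * 9 ^ (d * d) with hB
  have hB1 : 1 ≤ B := by
    have : (1 : ℝ) ≤ 9 ^ (d * d) := one_le_pow₀ (by norm_num)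
    linarith
  set b := Real.sqrt B with hb
  have hb2 : b ^ 2 = B := Real.sq_sqrt (by linarith)
  have hb1 : 1 ≤ b := Real.one_le_sqrt.mpr hB1
  -- Per Givens factor: `1150 = 1000 + 3·50` combines the error of the three-commutator formula with
  -- that of replacing the entries by net elements, and `12 = 3·4` counts lengths. Taking `τ = bt`
  -- with `b² = B` puts each factor within `τ²` of the identity.
  refine ⟨1 + (d * d : ℕ) * (1150 * b ^ 3), 1 + (d * d : ℕ) * 12, ?_, ?_,
    fun ρ hρ t r ht H g => ?_⟩
  · have : 0 ≤ ((d * d : ℕ) : ℝ) * (1150 * b ^ 3) := by positivity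
    linarith
  · have : 0 ≤ ((d * d : ℕ) : ℝ) * 12 := by positivity
    linarith
  obtain ⟨g₀, hg₀, hr₀⟩ := H g
  have hr : 0 ≤ r := (hρ.nonneg _).trans hr₀
  set τ := b * t with hτ
  have hτ0 : 0 ≤ τ := by positivity
  have hτ2 : τ ^ 2 = B * t ^ 2 := by rw [hτ, mul_pow, hb2]
  have htτ : t ^ 2 ≤ τ ^ 2 := by rw [hτ2]; nlinarith [sq_nonneg t]
  have hpair : ∀ (i j : Fin d) (hij : i ≠ j) (γ : SU 2), dist γ 1 ≤ τ ^ 2 →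
      ∃ x, dist (embedPair hij γ) x ≤ 1150 * τ ^ 3 ∧ ρ x ≤ 12 * r := by
    intro i j hij γ hγ
    have hcomm : ∀ a c : SU 2, dist a 1 ≤ 2 * τ ∧ dist c 1 ≤ 2 * τ →
        ∃ x, dist (embedPair hij ⁅a, c⁆) x ≤ 50 * τ ^ 3 ∧ ρ x ≤ 4 * r := by
      rintro a c ⟨ha, hc⟩
      have hle : ∀ a : SU 2, dist (embedPair hij a) 1 ≤ dist a 1 := fun a => by
        have := dist_embedPair_le hij a 1
        rwa [← embedPairHom_apply hij 1, map_one] at this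
      obtain ⟨a', ha', hra⟩ := H (embedPair hij a)
      obtain ⟨c', hc', hrc⟩ := H (embedPair hij c)
      refine ⟨⁅a', c'⁆, ?_, ?_⟩
      · rw [← embedPairHom_apply, map_commutatorElement, embedPairHom_apply, embedPairHom_apply]
        exact dist_commutator_le hτ0 (ha'.trans htτ) (hc'.trans htτ) ((hle a).trans ha)
          ((hle c).trans hc)
      · rw [commutatorElement_def]
        exact hρ.commutator_le hra hrc
    obtain ⟨a₁, b₁, a₂, b₂, a₃, b₃, h1, h2, h3, h⟩ := exists_commutators_near γ hτ0 hγ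
    obtain ⟨x₁, hx₁, hr₁⟩ := hcomm _ _ h1
    obtain ⟨x₂, hx₂, hr₂⟩ := hcomm _ _ h2
    obtain ⟨x₃, hx₃, hr₃⟩ := hcomm _ _ h3
    refine ⟨x₁ * x₂ * x₃, ?_, ?_⟩
    · have e1 := dist_embedPair_le hij γ (⁅a₁, b₁⁆ * ⁅a₂, b₂⁆ * ⁅a₃, b₃⁆)
      have e2 : embedPair hij (⁅a₁, b₁⁆ * ⁅a₂, b₂⁆ * ⁅a₃, b₃⁆) =
          embedPair hij ⁅a₁, b₁⁆ * embedPair hij ⁅a₂, b₂⁆ * embedPair hij ⁅a₃, b₃⁆ := by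
        simp only [← embedPairHom_apply, map_mul]
      rw [e2] at e1
      have e3 := dist_mul_mul_le (embedPair hij ⁅a₁, b₁⁆ * embedPair hij ⁅a₂, b₂⁆)
        (embedPair hij ⁅a₃, b₃⁆) (x₁ * x₂) x₃
      have e4 := dist_mul_mul_le (embedPair hij ⁅a₁, b₁⁆) (embedPair hij ⁅a₂, b₂⁆) x₁ x₂
      have e5 := dist_triangle (embedPair hij γ) (embedPair hij ⁅a₁, b₁⁆ *
        embedPair hij ⁅a₂, b₂⁆ * embedPair hij ⁅a₃, b₃⁆) (x₁ * x₂ * x₃)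
      linarith
    · have e1 := hρ.mul_le (x₁ * x₂) x₃
      have e2 := hρ.mul_le x₁ x₂
      linarith
  have hh : dist (g * g₀⁻¹) 1 ≤ t ^ 2 := by
    have := dist_mul_right_le g g₀ g₀⁻¹
    rw [mul_inv_cancel] at this
    exact this.trans hg₀
  obtain ⟨l, hl, hn, hx⟩ := pairProd_of_dist_le (g * g₀⁻¹) hh
  have hlist : ∀ l : List (SU d), (∀ x ∈ l, ∃ (i j : Fin d) (hij : i ≠ j) (γ : SU 2),
      x = embedPair hij γ ∧ dist γ 1 ≤ 8 * 9 ^ (d * d) * t ^ 2) →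
      ∃ x, dist l.prod x ≤ l.length * (1150 * τ ^ 3) ∧ ρ x ≤ l.length * (12 * r) := by
    intro l
    induction l with
    | nil => exact fun _ => ⟨1, by simp, by simp [hρ.one]⟩
    | cons y l ih =>
      intro h
      obtain ⟨x, hx, hrx⟩ := ih fun z hz => h z (by simp [hz])
      obtain ⟨i, j, hij, γ, rfl, hγ⟩ := h y (by simp)
      obtain ⟨x', hx', hrx'⟩ := hpair i j hij γ (by rw [hτ2]; exact hγ)
      refine ⟨x' * x, ?_, ?_⟩
      · have := dist_mul_mul_le (embedPair hij γ) l.prod x' x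
        rw [List.prod_cons, List.length_cons]
        push_cast
        linarith
      · have := hρ.mul_le x' x
        rw [List.length_cons]
        push_cast
        linarith
  obtain ⟨x, hx1, hx2⟩ := hlist l hx
  have hn' : (l.length : ℝ) ≤ (d * d : ℕ) := by exact_mod_cast hn
  refine ⟨x * g₀, ?_, ?_⟩
  · have e1 := dist_mul_right_le (g * g₀⁻¹) x g₀
    rw [inv_mul_cancel_right, ← hl] at e1
    refine e1.trans (hx1.trans ?_)
    have e2 : (l.length : ℝ) * (1150 * τ ^ 3) ≤ (d * d : ℕ) * (1150 * τ ^ 3) := by gcongr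
    refine e2.trans ?_
    rw [hτ]
    have : 0 ≤ t ^ 3 := by positivity
    nlinarith
  · have e1 := hρ.mul_le x g₀
    have e2 : (l.length : ℝ) * (12 * r) ≤ (d * d : ℕ) * (12 * r) := by gcongr
    nlinarith

/-- The Solovay–Kitaev theorem for length functions: a length function on `SU(d)` which is small
on a fixed net is small on `ε`-nets, up to a polylogarithmic loss. -/
theorem exists_solovayKitaev (d : ℕ) : ∃ (ε₀ K : ℝ) (A : ℕ), 0 < ε₀ ∧ 0 < K ∧
    ∀ ρ : SU d → ℝ, IsLength ρ → ∀ r : ℝ,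
      (∀ g, ∃ g', dist g g' ≤ ε₀ ∧ ρ g' ≤ r) →
      ∀ ε : ℝ, 0 < ε → ε ≤ 1 →
        ∀ g, ∃ g', dist g g' ≤ ε ∧ ρ g' ≤ K * (1 + Real.log (1 / ε)) ^ A * r := by
  obtain ⟨C, K, hC, hK, H⟩ := exists_solovayKitaev_step d
  -- After `n` rounds the cost is `Kⁿ` while the log of the inverse accuracy grows like `(3/2)ⁿ`;
  -- this `A` makes the cost at most its `A`-th power.
  obtain ⟨A, hA⟩ := pow_unbounded_of_one_lt K (by norm_num : (1 : ℝ) < 3 / 2)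
  have hC0 : C ≠ 0 := by linarith
  refine ⟨(Real.exp (-1) / C) ^ 2, (3 / 2) ^ A, A, by positivity, by positivity,
    fun ρ hρ r h0 ε hε hε1 g => ?_⟩
  have hr : 0 ≤ r := by
    obtain ⟨g', -, h⟩ := h0 1
    exact (hρ.nonneg _).trans h
  -- The scales `tₙ = exp(-(3/2)ⁿ)/C` solve `C·tₙ³ = tₙ₊₁²` exactly.
  have hind : ∀ n : ℕ, ∀ g, ∃ g', dist g g' ≤ (Real.exp (-(3 / 2) ^ n) / C) ^ 2 ∧
      ρ g' ≤ K ^ n * r := by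
    intro n
    induction n with
    | zero => simpa using h0
    | succ n ih =>
      intro g
      obtain ⟨g', h1, h2⟩ := H ρ hρ _ _ (by positivity) ih g
      refine ⟨g', h1.trans (le_of_eq ?_), h2.trans (le_of_eq ?_)⟩
      · have e : Real.exp (-(3 / 2) ^ n) ^ 3 = Real.exp (-(3 / 2) ^ (n + 1)) ^ 2 := by
          rw [← Real.exp_nat_mul, ← Real.exp_nat_mul]
          congr 1
          push_cast
          ring
        rw [div_pow (Real.exp _), div_pow (Real.exp _), e]
        field_simp
      · rw [pow_succ]; ring
  have hlog : 0 ≤ Real.log (1 / ε) := Real.log_nonneg (by rw [le_div_iff₀ hε]; linarith)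
  obtain ⟨m, hm1, hm2⟩ := exists_nat_pow_near (x := 1 + Real.log (1 / ε)) (by linarith)
    (by norm_num : (1 : ℝ) < 3 / 2)
  obtain ⟨g', h1, h2⟩ := hind (m + 1) g
  refine ⟨g', h1.trans ?_, h2.trans ?_⟩
  · have e1 : Real.exp (-(3 / 2) ^ (m + 1)) ≤ ε := by
      rw [← Real.le_log_iff_exp_le hε]
      rw [one_div, Real.log_inv] at hm2
      linarith
    have e2 : Real.exp (-(3 / 2) ^ (m + 1)) / C ≤ ε :=
      (div_le_self (Real.exp_pos _).le hC).trans e1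
    have e3 : 0 ≤ Real.exp (-(3 / 2) ^ (m + 1)) / C := by positivity
    nlinarith
  · refine mul_le_mul_of_nonneg_right ?_ hr
    calc K ^ (m + 1) ≤ ((3 / 2) ^ A) ^ (m + 1) := by gcongr
      _ = (3 / 2) ^ A * ((3 / 2) ^ m) ^ A := by ring
      _ ≤ _ := by gcongr

end SolovayKitaev

/-! ### Coarse nets from density of the generated subgroup -/

section Nets

open Filter Topology
open scoped commutatorElement

/-- Nets of controlled length, uniformly over a family of length functions that are controlled
somewhere in every open set meeting `S`. -/
theorem exists_net_of_reachable {Γ : Type*} [Group Γ] [TopologicalSpace Γ] {S : Set Γ}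
    {X : Type*} [PseudoMetricSpace X] [CompactSpace X] (i : X → Γ) (hi : ∀ x, Reachable S (i x))
    {ε : ℝ} (hε : 0 < ε) (hU : ∀ x, i '' Metric.ball x (ε / 2) ∈ 𝓝 (i x))
    (F : (Γ → ℝ) → ℝ → Prop) (hlen : ∀ ρ s, F ρ s → IsLength ρ ∧ 0 ≤ s)
    (hloc : ∀ V, IsOpen V → (S ∩ V).Nonempty → ∃ M : ℝ, ∀ ρ s, F ρ s → ∃ γ ∈ V, ρ γ ≤ M * s) :
    ∃ M : ℝ, 0 ≤ M ∧ ∀ ρ s, F ρ s → ∀ x, ∃ x', dist x x' ≤ ε ∧ ρ (i x') ≤ M * s := by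
  obtain ⟨𝒱, hf, hV, L, hL⟩ := Reachable.exists_uniform i hi hε hU
  choose! M hM using fun V hV' => hloc V (hV V hV').1 (hV V hV').2
  obtain ⟨B, hB⟩ := (hf.image M).bddAbove
  refine ⟨L * max B 0, by positivity, fun ρ s h x => ?_⟩
  obtain ⟨hρ, hs⟩ := hlen ρ s h
  obtain ⟨x', h1, h2⟩ := hL ρ hρ (max B 0 * s) (by positivity) (fun V hV' => by
    obtain ⟨γ, hγ, h3⟩ := hM V hV' ρ s h
    refine ⟨γ, hγ, h3.trans (mul_le_mul_of_nonneg_right ?_ hs)⟩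
    exact (hB (Set.mem_image_of_mem M hV')).trans (le_max_left _ _)) x
  exact ⟨x', h1, h2.trans (le_of_eq (by ring))⟩

/-- If `T` generates a dense subgroup of `G`, then commutators `(⁅a, b⁆, 0)` are robustly reachable
from `T × {1}` in `G × ℤ`. -/
theorem reachable_commutator {G : Type*} [Group G] [TopologicalSpace G] [IsTopologicalGroup G]
    {T : Set G} (hT : Dense (Subgroup.closure T : Set G)) (a b : G) :
    (⁅a, b⁆, 1) ∈ reachableSubgroup ((fun s => (s, Multiplicative.ofAdd (1 : ℤ))) '' T) := by
  set S : Set (G × Multiplicative ℤ) := (fun s => (s, Multiplicative.ofAdd (1 : ℤ))) '' T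
  set R := reachableSubgroup S
  have hD : Dense ((R.map (MonoidHom.fst _ _) : Subgroup G) : Set G) := by
    refine hT.mono ((Subgroup.closure_le _).mpr fun s hs => ?_)
    exact ⟨_, subset_reachableSubgroup S (Set.mem_image_of_mem _ hs), rfl⟩
  -- The second coordinates commute, so commutators of elements of `R` have trivial integer part
  -- whatever their word lengths; closedness passes from the dense projection of `R` to all pairs.
  have hclosed : IsClosed {p : G × G | ((⁅p.1, p.2⁆, 1) : G × Multiplicative ℤ) ∈ R} := by
    refine (isClosed_reachableSubgroup S).preimage ?_
    simp only [commutatorElement_def]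
    fun_prop
  have hsub : ((R.map (MonoidHom.fst _ _) : Subgroup G) : Set G) ×ˢ
      ((R.map (MonoidHom.fst _ _) : Subgroup G) : Set G) ⊆
      {p : G × G | ((⁅p.1, p.2⁆, 1) : G × Multiplicative ℤ) ∈ R} := by
    rintro ⟨-, -⟩ ⟨⟨⟨a, m⟩, ha, rfl⟩, ⟨⟨b, n⟩, hb, rfl⟩⟩
    have h : ⁅((a, m) : G × Multiplicative ℤ), (b, n)⁆ ∈ R := by
      rw [commutatorElement_def]
      exact R.mul_mem (R.mul_mem (R.mul_mem ha hb) (R.inv_mem ha)) (R.inv_mem hb)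
    have h2 : ⁅((a, m) : G × Multiplicative ℤ), (b, n)⁆ = (⁅a, b⁆, 1) := by
      refine Prod.ext rfl ?_
      change ⁅m, n⁆ = 1
      rw [commutatorElement_eq_one_iff_mul_comm, mul_comm]
    rw [h2] at h
    exact h
  have h := closure_minimal hsub hclosed
  rw [(hD.prod hD).closure_eq] at h
  exact h (Set.mem_univ (a, b))

theorem reachable_prod_one {η : Measure (SU 2)} (hη : GeneratesDense η) (γ : SU 2) :
    Reachable ((fun s => (s, Multiplicative.ofAdd (1 : ℤ))) '' η.support) (γ, 1) := by
  have htop : (reachableSubgroup ((fun s => (s, Multiplicative.ofAdd (1 : ℤ))) '' η.support)).comap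
      (MonoidHom.inl (SU 2) (Multiplicative ℤ)) = ⊤ :=
    subgroup_eq_top_of_commutators fun a b => reachable_commutator hη a b
  have h : γ ∈ (⊤ : Subgroup (SU 2)) := Subgroup.mem_top γ
  rw [← htop] at h
  exact h

/-- The hypothesis on `ρ` is Chebyshev's conclusion for a quadratic mean `s`. The constant `M`
depends on `η` and `ε` only, so one net serves all dimensions, functions and choices of the
commuting element `σ`. -/
theorem exists_net_prod {η : Measure (SU 2)} [IsFiniteMeasure η] (hη : GeneratesDense η) {ε : ℝ}
    (hε : 0 < ε) : ∃ M : ℝ, 0 ≤ M ∧ ∀ (ρ : SU 2 × Multiplicative ℤ → ℝ) (s : ℝ),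
      IsLength ρ → 0 ≤ s →
      (∀ (U : Set (SU 2)) (m : ℝ), 0 < m → m ≤ η.real U →
        ∃ γ ∈ U, ρ (γ, Multiplicative.ofAdd 1) ≤ s / Real.sqrt m) →
      ∀ γ, ∃ γ', dist γ γ' ≤ ε ∧ ρ (γ', 1) ≤ M * s := by
  obtain ⟨M, hM, h⟩ := exists_net_of_reachable (fun γ : SU 2 => (γ, (1 : Multiplicative ℤ)))
    (reachable_prod_one hη) hε (fun γ => by
      rw [← Set.prod_singleton]
      exact prod_mem_nhds (Metric.ball_mem_nhds γ (half_pos hε)) (by simp))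
    (fun ρ s => IsLength ρ ∧ 0 ≤ s ∧ ∀ (U : Set (SU 2)) (m : ℝ), 0 < m → m ≤ η.real U →
      ∃ γ ∈ U, ρ (γ, Multiplicative.ofAdd 1) ≤ s / Real.sqrt m)
    (fun ρ s h => ⟨h.1, h.2.1⟩) (fun V hV hSV => by
      obtain ⟨-, ⟨g, hg, rfl⟩, hgV⟩ := hSV
      set U := (fun γ : SU 2 => (γ, Multiplicative.ofAdd (1 : ℤ))) ⁻¹' V
      have hU : IsOpen U := hV.preimage (by fun_prop)
      have hpos := (Measure.mem_support_iff_forall g).mp hg _ (hU.mem_nhds hgV)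
      refine ⟨1 / Real.sqrt (η.real U), fun ρ s h => ?_⟩
      obtain ⟨γ, hγ, hγ'⟩ := h.2.2 U (η.real U) (ENNReal.toReal_pos hpos.ne' (measure_ne_top _ _)) le_rfl
      exact ⟨_, hγ, hγ'.trans (le_of_eq (by ring))⟩)
  exact ⟨M, hM, fun ρ s h1 h2 h3 => h ρ s ⟨h1, h2, h3⟩⟩

variable {d : ℕ}

/-- The assumption concerns `g⁻¹h`, while displacements control `gh⁻¹`. Conjugating by a point `s`
of the support exchanges them: `s(g⁻¹h)s⁻¹ = (sg⁻¹)(hs⁻¹)`. -/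
theorem dense_closure_mul_inv {P : Measure (SU d)} [IsProbabilityMeasure P]
    (hP : GeneratesDense (P.inv.mconv P)) :
    Dense (Subgroup.closure {x : SU d | ∃ g ∈ P.support, ∃ h ∈ P.support, x = g * h⁻¹} :
      Set (SU d)) := by
  set S₀ : Set (SU d) := {x | ∃ g ∈ P.support, ∃ h ∈ P.support, x = g⁻¹ * h}
  set S₁ : Set (SU d) := {x | ∃ g ∈ P.support, ∃ h ∈ P.support, x = g * h⁻¹}
  have hsupp : (P.inv.mconv P).support ⊆ closure S₀ := by
    refine Measure.support_subset_of_isClosed isClosed_closure ?_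
    change ∀ᵐ x ∂(P.inv.mconv P), x ∈ closure S₀
    have hPs : ∀ᵐ x ∂P, x ∈ P.support := Measure.support_mem_ae
    have hPi : ∀ᵐ x ∂P.inv, x⁻¹ ∈ P.support := by
      refine (ae_map_iff (by fun_prop) ?_).mpr ?_
      · exact (Measure.isClosed_support.preimage continuous_inv).measurableSet
      · simpa using hPs
    refine (ae_map_iff (by fun_prop) isClosed_closure.measurableSet).mpr ?_
    filter_upwards [Measure.quasiMeasurePreserving_fst.ae hPi,
      Measure.quasiMeasurePreserving_snd.ae hPs] with p h1 h2
    exact subset_closure ⟨p.1⁻¹, h1, p.2, h2, by rw [inv_inv]⟩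
  have hdense : Dense (Subgroup.closure S₀ : Set (SU d)) := by
    have h : Subgroup.closure (P.inv.mconv P).support ≤
        (Subgroup.closure S₀).topologicalClosure := by
      refine (Subgroup.closure_le _).mpr (hsupp.trans ?_)
      exact closure_mono Subgroup.subset_closure
    rw [← dense_closure]
    exact Dense.mono h hP
  obtain ⟨s, hs⟩ := Measure.nonempty_support (IsProbabilityMeasure.ne_zero P)
  have himg := (MulAut.conj s).surjective.denseRange.dense_image
    (show Continuous fun x => s * x * s⁻¹ by fun_prop) hdense
  refine himg.mono ?_
  have hle : Subgroup.closure S₀ ≤ (Subgroup.closure S₁).comap (MulAut.conj s).toMonoidHom := by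
    refine (Subgroup.closure_le _).mpr ?_
    rintro - ⟨g, hg, h, hh, rfl⟩
    change s * (g⁻¹ * h) * s⁻¹ ∈ Subgroup.closure S₁
    rw [show s * (g⁻¹ * h) * s⁻¹ = s * g⁻¹ * (h * s⁻¹) by group]
    exact Subgroup.mul_mem _ (Subgroup.subset_closure ⟨s, hs, g, hg, rfl⟩)
      (Subgroup.subset_closure ⟨h, hh, s, hs, rfl⟩)
  rintro - ⟨x, hx, rfl⟩
  exact hle hx

/-- Here `ψ` stands for the deviation of the translate `f(g·)` from `Tf`, and `ρ` for the
displacement. -/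
theorem exists_net_mul_inv {P : Measure (SU d)} [IsProbabilityMeasure P]
    (hP : GeneratesDense (P.inv.mconv P)) {ε : ℝ} (hε : 0 < ε) :
    ∃ M : ℝ, 0 ≤ M ∧ ∀ (ρ ψ : SU d → ℝ) (s : ℝ), IsLength ρ → 0 ≤ s →
      (∀ g h, ρ (g * h⁻¹) ≤ ψ g + ψ h) →
      (∀ (U : Set (SU d)) (m : ℝ), 0 < m → m ≤ P.real U → ∃ γ ∈ U, ψ γ ≤ s / Real.sqrt m) →
      ∀ γ, ∃ γ', dist γ γ' ≤ ε ∧ ρ γ' ≤ M * s := by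
  have htop := reachableSubgroup_eq_top (dense_closure_mul_inv hP)
  obtain ⟨M, hM, h⟩ := exists_net_of_reachable (fun γ : SU d => γ)
    (S := {x : SU d | ∃ g ∈ P.support, ∃ h ∈ P.support, x = g * h⁻¹})
    (fun γ => mem_reachableSubgroup.mp (by rw [htop]; trivial)) hε
    (fun γ => by
      rw [Set.image_id']
      exact Metric.ball_mem_nhds γ (half_pos hε))
    (fun ρ s => IsLength ρ ∧ 0 ≤ s ∧ ∃ ψ : SU d → ℝ, (∀ g h, ρ (g * h⁻¹) ≤ ψ g + ψ h) ∧
      (∀ (U : Set (SU d)) (m : ℝ), 0 < m → m ≤ P.real U → ∃ γ ∈ U, ψ γ ≤ s / Real.sqrt m))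
    (fun ρ s h => ⟨h.1, h.2.1⟩) (fun V hV hSV => by
      obtain ⟨-, ⟨g, hg, h, hh, rfl⟩, hV'⟩ := hSV
      have hcont : ContinuousAt (fun p : SU d × SU d => p.1 * p.2⁻¹) (g, h) := by fun_prop
      obtain ⟨A, hA, B, hB, hAB⟩ := mem_nhds_prod_iff.mp (hcont (hV.mem_nhds hV'))
      have hpA := (Measure.mem_support_iff_forall g).mp hg _ hA
      have hpB := (Measure.mem_support_iff_forall h).mp hh _ hB
      refine ⟨1 / Real.sqrt (P.real A) + 1 / Real.sqrt (P.real B), fun ρ s h => ?_⟩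
      obtain ⟨-, -, ψ, hψ, hhit⟩ := h
      obtain ⟨a, ha, ha'⟩ := hhit A (P.real A) (ENNReal.toReal_pos hpA.ne' (measure_ne_top _ _)) le_rfl
      obtain ⟨b, hb, hb'⟩ := hhit B (P.real B) (ENNReal.toReal_pos hpB.ne' (measure_ne_top _ _)) le_rfl
      refine ⟨a * b⁻¹, hAB (Set.mk_mem_prod ha hb), (hψ a b).trans ?_⟩
      have e : (1 / Real.sqrt (P.real A) + 1 / Real.sqrt (P.real B)) * s =
        s / Real.sqrt (P.real A) + s / Real.sqrt (P.real B) := by ring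
      rw [e]
      exact add_le_add ha' hb')
  exact ⟨M, hM, fun ρ ψ s h1 h2 h3 h4 => h ρ s ⟨h1, h2, ψ, h3, h4⟩⟩

end Nets

/-! ### From a nearly norm-preserving average to small displacements -/

section Walk

open Filter Topology

variable {d : ℕ}

theorem val_add_one_eq [d.AtLeastTwo] (i : Fin d) :
    (i + 1 : Fin d).val = if i.val + 1 < d then i.val + 1 else 0 := by
  have hd := Nat.AtLeastTwo.prop (n := d)
  have hi := i.2
  rw [Fin.val_add, Fin.val_one', Nat.add_mod_mod]
  split_ifs with h
  · exact Nat.mod_eq_of_lt h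
  · rw [show i.val + 1 = d by omega, Nat.mod_self]

theorem isProbabilityMeasure_pairMeasure (η : Measure (SU 2)) [IsProbabilityMeasure η]
    {i j : Fin d} (hij : i ≠ j) : IsProbabilityMeasure (pairMeasure η hij) :=
  Measure.isProbabilityMeasure_map (continuous_embedPair hij).aemeasurable

instance isProbabilityMeasure_stepMeasure (η : Measure (SU 2)) [IsProbabilityMeasure η] (d : ℕ)
    [d.AtLeastTwo] : IsProbabilityMeasure (stepMeasure η d) where
  measure_univ := by
    have h : ∀ i : Fin d, pairMeasure η (ne_succ i) Set.univ = 1 := fun i =>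
      (isProbabilityMeasure_pairMeasure η (ne_succ i)).measure_univ
    have hd : (d : ℝ≥0∞) ≠ 0 := by
      have := Nat.AtLeastTwo.prop (n := d)
      simp only [ne_eq, Nat.cast_eq_zero]
      omega
    simp [stepMeasure, h, ENNReal.inv_mul_cancel hd (ENNReal.natCast_ne_top d)]

theorem integral_stepMeasure {E : Type*} [NormedAddCommGroup E] [NormedSpace ℝ E]
    (η : Measure (SU 2)) [IsProbabilityMeasure η] [d.AtLeastTwo] {u : SU d → E}
    (hu : Continuous u) : ∫ g, u g ∂(stepMeasure η d) =
      (d : ℝ)⁻¹ • ∑ i : Fin d, ∫ g, u g ∂(pairMeasure η (ne_succ i)) := by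
  rw [stepMeasure, integral_smul_measure, integral_finsetSum_measure]
  · simp
  · intro i _
    have := isProbabilityMeasure_pairMeasure η (ne_succ i)
    exact integrable_of_continuous hu

theorem avgOp_eq (η : Measure (SU 2)) [IsProbabilityMeasure η] [d.AtLeastTwo] {f : SU d → ℂ}
    (hf : Continuous f) : avgOp η d f = fun x => ∫ g, f (g * x) ∂(stepMeasure η d) := by
  funext x
  rw [integral_stepMeasure η (by fun_prop), avgOp, ← Complex.coe_smul, smul_eq_mul]
  simp

/-- The mean square deviation of the translates of `f` from `T f`. -/
theorem integral_deviation_le (η : Measure (SU 2)) [IsProbabilityMeasure η] [d.AtLeastTwo]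
    {f : SU d → ℂ} {K : ℝ≥0} (hf : LipschitzWith K f) (h1 : l2Norm f = 1) {κ : ℝ}
    (hT : 1 - κ ≤ l2Norm (avgOp η d f)) :
    ∫ g, l2Norm (fun x => f (g * x) - avgOp η d f x) ^ 2 ∂(stepMeasure η d) ≤ 2 * κ := by
  have h := integral_l2Norm_sub_average_sq hf (stepMeasure η d)
  rw [avgOp_eq η hf.continuous] at hT ⊢
  rw [h, h1]
  -- With `x = ‖Tf‖₂`, `1 - x² = 2(1-x) - (1-x)² ≤ 2κ`.
  nlinarith [sq_nonneg (l2Norm (fun x => ∫ g, f (g * x) ∂(stepMeasure η d)) - 1)]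

theorem continuous_avgOp (η : Measure (SU 2)) [IsProbabilityMeasure η] [d.AtLeastTwo]
    {f : SU d → ℂ} {K : ℝ≥0} (hf : LipschitzWith K f) : Continuous (avgOp η d f) := by
  rw [avgOp_eq η hf.continuous]
  exact continuous_integral_mul hf _

/-- Each of the `d` pairs has weight `1/d` in the step distribution, so localising to one pair costs
a factor `d`. -/
theorem integral_deviation_embedPair_le (η : Measure (SU 2)) [IsProbabilityMeasure η]
    [d.AtLeastTwo] {f : SU d → ℂ} {K : ℝ≥0} (hf : LipschitzWith K f) (h1 : l2Norm f = 1) {κ : ℝ}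
    (hT : 1 - κ ≤ l2Norm (avgOp η d f)) (i : Fin d) :
    ∫ γ, l2Norm (fun x => f (embedPair (ne_succ i) γ * x) - avgOp η d f x) ^ 2 ∂η ≤
      2 * κ * d := by
  have hd : (0 : ℝ) < d := by
    have := Nat.AtLeastTwo.prop (n := d)
    exact_mod_cast (by omega : 0 < d)
  have hcont := continuous_l2Norm_mul_sub hf (continuous_avgOp η hf)
  have h := integral_deviation_le η hf h1 hT
  rw [integral_stepMeasure η (by fun_prop), smul_eq_mul, inv_mul_le_iff₀ hd] at h
  have e : ∀ i : Fin d, ∫ g, l2Norm (fun x => f (g * x) - avgOp η d f x) ^ 2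
      ∂(pairMeasure η (ne_succ i)) =
      ∫ γ, l2Norm (fun x => f (embedPair (ne_succ i) γ * x) - avgOp η d f x) ^ 2 ∂η := fun i =>
    integral_map (continuous_embedPair (ne_succ i)).aemeasurable
      (by exact (hcont.pow 2).aestronglyMeasurable)
  simp only [e] at h
  have h2 := Finset.single_le_sum (f := fun i : Fin d =>
    ∫ γ, l2Norm (fun x => f (embedPair (ne_succ i) γ * x) - avgOp η d f x) ^ 2 ∂η)
    (fun i _ => integral_nonneg fun γ => by positivity) (Finset.mem_univ i)
  linarith

/-- A set of mass `m` contains a point where a nonnegative function is at most its quadratic mean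
divided by `√m`. -/
theorem exists_mem_le_div_sqrt {X : Type*} [TopologicalSpace X] [CompactSpace X] [T2Space X]
    [MeasurableSpace X] [BorelSpace X] [SecondCountableTopology X] {P : Measure X}
    [IsProbabilityMeasure P] {φ : X → ℝ} (hφ : Continuous φ) {w : ℝ}
    (hw : ∫ x, φ x ^ 2 ∂P ≤ w) {U : Set X} {m : ℝ} (hm : 0 < m) (hU : m ≤ P.real U) :
    ∃ x ∈ U, φ x ≤ Real.sqrt w / Real.sqrt m := by
  obtain ⟨x, hx, h⟩ := exists_mem_le_integral_div (integrable_of_continuous (hφ.pow 2))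
    (fun x => sq_nonneg (φ x)) hm hU
  refine ⟨x, hx, ?_⟩
  rw [← Real.sqrt_div' _ hm.le]
  exact Real.le_sqrt_of_sq_le (h.trans (div_le_div_of_nonneg_right hw hm.le))

/-- Displacements after the Solovay–Kitaev iteration, from a net of elements of small length. -/
theorem le_of_solovayKitaev {ε₀ K₀ : ℝ} {A : ℕ}
    (H : ∀ ρ : SU d → ℝ, IsLength ρ → ∀ r : ℝ, (∀ g, ∃ g', dist g g' ≤ ε₀ ∧ ρ g' ≤ r) →
      ∀ ε : ℝ, 0 < ε → ε ≤ 1 →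
        ∀ g, ∃ g', dist g g' ≤ ε ∧ ρ g' ≤ K₀ * (1 + Real.log (1 / ε)) ^ A * r)
    {ρ : SU d → ℝ} (hρ : IsLength ρ) {K : ℝ} (hK0 : 0 ≤ K) (hK : ∀ g, ρ g ≤ K * dist g 1) {r : ℝ}
    (hr : ∀ g, ∃ g', dist g g' ≤ ε₀ ∧ ρ g' ≤ r) {ε : ℝ} (hε : 0 < ε) (hε1 : ε ≤ 1) (g : SU d) :
    ρ g ≤ K * ε + K₀ * (1 + Real.log (1 / ε)) ^ A * r := by
  obtain ⟨g', h1, h2⟩ := H ρ hρ r hr ε hε hε1 g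
  have h3 := hρ.mul_le (g * g'⁻¹) g'
  rw [inv_mul_cancel_right] at h3
  have h4 := hK (g * g'⁻¹)
  have h5 : dist (g * g'⁻¹) 1 ≤ ε := by
    have := dist_mul_right_le g g' g'⁻¹
    rw [mul_inv_cancel] at this
    exact this.trans h1
  have h6 : K * dist (g * g'⁻¹) 1 ≤ K * ε := by gcongr
  linarith

/-- Near invariance under a fixed dense random walk on `SU(d)` gives near invariance under all of
`SU(d)`. -/
theorem displacement_le_of_generatesDense (d : ℕ) [d.AtLeastTwo] : ∃ A : ℕ,
    ∀ (η : Measure (SU 2)) [IsProbabilityMeasure η],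
      GeneratesDense ((stepMeasure η d).inv.mconv (stepMeasure η d)) →
      ∃ c : ℝ, 0 ≤ c ∧ ∀ (f : SU d → ℂ) (K : ℝ≥0) (κ : ℝ), LipschitzWith K f → l2Norm f = 1 →
        1 - κ ≤ l2Norm (avgOp η d f) → ∀ ε : ℝ, 0 < ε → ε ≤ 1 → ∀ g,
          displacement f g ≤ K * ε + c * (1 + Real.log (1 / ε)) ^ A * Real.sqrt κ := by
  obtain ⟨ε₀, K₀, A, hε₀, hK₀, H⟩ := exists_solovayKitaev d
  refine ⟨A, fun η _ hη => ?_⟩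
  obtain ⟨M, hM, hnet⟩ := exists_net_mul_inv hη hε₀
  refine ⟨K₀ * M * Real.sqrt 2, by positivity, fun f K κ hf h1 hT ε hε hε1 g => ?_⟩
  have hF := continuous_avgOp η hf
  have hlen := isLength_displacement hf.continuous
  have h := hnet (displacement f) (fun g => l2Norm fun x => f (g * x) - avgOp η d f x)
    (Real.sqrt (2 * κ)) hlen (Real.sqrt_nonneg _)
    (fun g h => displacement_mul_inv_le hf.continuous hF g h)
    (fun U m hm hU => exists_mem_le_div_sqrt (continuous_l2Norm_mul_sub hf hF)
      (integral_deviation_le η hf h1 hT) hm hU)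
  refine (le_of_solovayKitaev H hlen K.2 (displacement_le_dist hf) h hε hε1 g).trans (le_of_eq ?_)
  rw [Real.sqrt_mul (by norm_num)]
  simp only [NNReal.val_eq_coe]
  ring

/-- Near invariance on adjacent copies of `SU(2)`, for `d ≥ 4`. -/
theorem displacement_embedPair_le : ∃ A : ℕ, ∀ (η : Measure (SU 2)) [IsProbabilityMeasure η],
    GeneratesDense η → ∃ c : ℝ, 0 ≤ c ∧ ∀ (d : ℕ) [d.AtLeastTwo], 4 ≤ d →
      ∀ (f : SU d → ℂ) (K : ℝ≥0) (κ : ℝ), LipschitzWith K f → l2Norm f = 1 →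
        1 - κ ≤ l2Norm (avgOp η d f) → ∀ ε : ℝ, 0 < ε → ε ≤ 1 → ∀ (i : Fin d) (γ : SU 2),
          displacement f (embedPair (ne_succ i) γ) ≤
            K * ε + c * (1 + Real.log (1 / ε)) ^ A * Real.sqrt (κ * d) := by
  obtain ⟨ε₀, K₀, A, hε₀, hK₀, H⟩ := exists_solovayKitaev 2
  refine ⟨A, fun η _ hη => ?_⟩
  obtain ⟨M, hM, hnet⟩ := exists_net_prod hη hε₀
  refine ⟨K₀ * M * (2 * Real.sqrt 2), by positivity,
    fun d _ hd f K κ hf h1 hT ε hε hε1 i γ => ?_⟩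
  have hF := continuous_avgOp η hf
  have hlen := isLength_displacement hf.continuous
  -- This is where `d ≥ 4` is needed: the pairs `(i, i+1)` and `(i+2, i+3)` are disjoint.
  have hdisj : i ≠ i + 1 + 1 ∧ i ≠ i + 1 + 1 + 1 ∧ i + 1 ≠ i + 1 + 1 ∧ i + 1 ≠ i + 1 + 1 + 1 := by
    have h0 := i.2
    have h1 := val_add_one_eq i
    have h2 := val_add_one_eq (i + 1)
    have h3 := val_add_one_eq (i + 1 + 1)
    simp only [ne_eq, Fin.ext_iff]
    split_ifs at h1 h2 h3 <;> omega
  have hcont : ∀ i : Fin d, Continuous fun γ =>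
      l2Norm (fun x => f (embedPair (ne_succ i) γ * x) - avgOp η d f x) := fun i =>
    (continuous_l2Norm_mul_sub hf hF).comp (continuous_embedPair (ne_succ i))
  obtain ⟨σ, -, hσ⟩ := exists_mem_le_div_sqrt (P := η) (U := Set.univ) (m := 1)
    (hcont (i + 1 + 1)) (integral_deviation_embedPair_le η hf h1 hT (i + 1 + 1)) one_pos (by simp)
  rw [Real.sqrt_one, div_one] at hσ
  set s := Real.sqrt (2 * κ * d) with hs
  set σ' := embedPair (ne_succ (i + 1 + 1)) σ
  have hcomm : ∀ γ (n : Multiplicative ℤ), Commute (embedPairHom (ne_succ i) γ)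
      (zpowersHom (SU d) σ'⁻¹ n) := fun γ n => by
    rw [zpowersHom_apply]
    exact ((commute_embedPair (ne_succ i) (ne_succ (i + 1 + 1)) hdisj.1 hdisj.2.1 hdisj.2.2.1
      hdisj.2.2.2 γ σ).inv_right).zpow_right _
  -- The map `(γ, n) ↦ γσ'⁻ⁿ`, a homomorphism because the copies commute. Pulling the displacement
  -- back along it gives a length on a group that does not involve `d`.
  set Φ : SU 2 × Multiplicative ℤ →* SU d :=
    (embedPairHom (ne_succ i)).noncommCoprod (zpowersHom (SU d) σ'⁻¹) hcomm
  have hΦ1 : ∀ γ, Φ (γ, 1) = embedPair (ne_succ i) γ := fun γ => by simp [Φ]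
  have hΦ : ∀ γ, Φ (γ, Multiplicative.ofAdd 1) = embedPair (ne_succ i) γ * σ'⁻¹ := fun γ => by
    simp [Φ]
  have h := hnet (fun p => displacement f (Φ p)) (2 * s) (hlen.comp Φ) (by positivity)
    (fun U m hm hU => by
      obtain ⟨γ, hγ, h⟩ := exists_mem_le_div_sqrt (hcont i)
        (integral_deviation_embedPair_le η hf h1 hT i) hm hU
      refine ⟨γ, hγ, ?_⟩
      rw [hΦ]
      have hm1 : Real.sqrt m ≤ 1 := Real.sqrt_le_one.mpr (hU.trans measureReal_le_one)
      have hs1 : s ≤ s / Real.sqrt m :=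
        le_div_self (Real.sqrt_nonneg _) (Real.sqrt_pos.mpr hm) hm1
      have := displacement_mul_inv_le hf.continuous hF (embedPair (ne_succ i) γ) σ'
      rw [mul_div_assoc]
      linarith)
  simp only [hΦ1] at h
  have hlip : ∀ γ, displacement f (embedPairHom (ne_succ i) γ) ≤ K * dist γ 1 := fun γ => by
    refine (displacement_le_dist hf _).trans (mul_le_mul_of_nonneg_left ?_ K.2)
    have := dist_embedPair_le (ne_succ i) γ 1
    rwa [← embedPairHom_apply (ne_succ i) 1, map_one] at this
  refine (le_of_solovayKitaev H (hlen.comp (embedPairHom (ne_succ i))) K.2 hlip h hε hε1 γ).trans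
    (le_of_eq ?_)
  rw [hs, mul_assoc 2 κ, Real.sqrt_mul (by norm_num)]
  simp only [NNReal.val_eq_coe]
  ring

theorem conjTranspose_pairMatrix_mul (i j k l : Fin d) :
    (pairMatrix i j)ᴴ * pairMatrix k l =
      Matrix.of fun a b => if ![i, j] a = ![k, l] b then 1 else 0 := by
  ext a b
  rw [Matrix.mul_apply, Finset.sum_eq_single (![i, j] a)]
  · simp [pairMatrix]
  · intro m _ hm
    simp [pairMatrix, hm]
  · simp

/-- Embedded copies of `SU(2)` with a common first index are conjugate. -/
theorem exists_conj_embedPair {i j k : Fin d} (hij : i ≠ j) (hik : i ≠ k) (hjk : j ≠ k) :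
    ∃ w : SU 2, ∀ γ, embedPair hik γ = embedPair hjk w * embedPair hij γ * (embedPair hjk w)⁻¹ := by
  have hw : ‖(0 : ℂ)‖ ^ 2 + ‖(-1 : ℂ)‖ ^ 2 = 1 := by simp
  -- This quarter turn sends `e_j` to `e_k` and fixes `e_i`.
  refine ⟨su2 0 (-1) hw, fun γ => eq_mul_inv_of_mul_eq (Subtype.ext ?_)⟩
  have hWV : (embedPair hjk (su2 0 (-1) hw)).1 * pairMatrix i j = pairMatrix i k := by
    rw [coe_embedPair, Matrix.add_mul, Matrix.one_mul, Matrix.mul_assoc, conjTranspose_pairMatrix_mul, coe_su2]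
    ext m a
    fin_cases a
    · simp [pairMatrix_apply_zero, pairMatrix_apply_one, quat, Matrix.mul_apply, hij.symm, hik.symm]
    · simp [pairMatrix_apply_zero, pairMatrix_apply_one, quat, Matrix.mul_apply, hjk.symm]
      split_ifs <;> simp
  have hVW : (pairMatrix i k)ᴴ * (embedPair hjk (su2 0 (-1) hw)).1 = (pairMatrix i j)ᴴ := by
    have h := Matrix.mem_unitaryGroup_iff'.mp (embedPair hjk (su2 0 (-1) hw)).2.1
    rw [← hWV, Matrix.conjTranspose_mul, Matrix.mul_assoc, ← Matrix.star_eq_conjTranspose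
      (embedPair hjk (su2 0 (-1) hw)).1, h, Matrix.mul_one]
  generalize embedPair hjk (su2 0 (-1) hw) = W at *
  rw [Submonoid.coe_mul, Submonoid.coe_mul, coe_embedPair, coe_embedPair, add_mul, mul_add,
    Matrix.mul_assoc, hVW, ← Matrix.mul_assoc, ← Matrix.mul_assoc, hWV, one_mul, mul_one]

/-- Lengths of arbitrary embedded copies of `SU(2)`, from those of adjacent ones. -/
theorem IsLength.embedPair_le [d.AtLeastTwo] {ρ : SU d → ℝ} (hρ : IsLength ρ) {r : ℝ}
    (h : ∀ (i : Fin d) γ, ρ (embedPair (ne_succ i) γ) ≤ r) {i j : Fin d} (hij : i ≠ j) (γ : SU 2) :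
    ρ (embedPair hij γ) ≤ 2 * d * r := by
  have hr : 0 ≤ r := (hρ.nonneg _).trans (h 0 1)
  -- Walk around the cycle from `i` to `j = i + k`; moving the second index one step is conjugation
  -- by an adjacent element and adds at most `2r`.
  have H : ∀ k : ℕ, ∀ j : Fin d, (j : ℕ) = (i + k) % d → ∀ hij : i ≠ j,
      ρ (embedPair hij γ) ≤ 2 * k * r := by
    intro k
    induction k with
    | zero =>
      intro j hj hij
      exact absurd (Fin.ext (by rw [hj, add_zero, Nat.mod_eq_of_lt i.2])) hij
    | succ k ih =>
      intro j hj hij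
      obtain ⟨l, hl⟩ : ∃ l : Fin d, (l : ℕ) = (i + k) % d :=
        ⟨⟨(i + k) % d, Nat.mod_lt _ (Fin.pos i)⟩, rfl⟩
      have hlj : j = l + 1 := by
        refine Fin.ext ?_
        rw [hj, Fin.val_add, Fin.val_one', Nat.add_mod_mod, hl, Nat.mod_add_mod, add_assoc]
      subst hlj
      push_cast
      have hk : (0 : ℝ) ≤ 2 * k * r := by positivity
      by_cases hil : i = l
      · subst hil
        have := h i γ
        linarith
      · obtain ⟨w, hw⟩ := exists_conj_embedPair hil hij (ne_succ l)
        rw [hw γ]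
        have h1 := hρ.mul_le (embedPair (ne_succ l) w * embedPair hil γ)
          (embedPair (ne_succ l) w)⁻¹
        have h2 := hρ.mul_le (embedPair (ne_succ l) w) (embedPair hil γ)
        have h3 := hρ.inv_le (embedPair (ne_succ l) w)
        have h4 := h l w
        have h5 := ih l hl hil
        linarith
  have hi := i.2
  have hj := j.2
  refine (H ((j + (d - i)) % d) j ?_ hij).trans ?_
  · rw [Nat.add_mod_mod, show (i : ℕ) + (j + (d - i)) = j + d by omega, Nat.add_mod_right,
      Nat.mod_eq_of_lt hj]
  · have : (((j + (d - i)) % d : ℕ) : ℝ) ≤ d := by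
      exact_mod_cast (Nat.mod_lt _ (Fin.pos i)).le
    gcongr

theorem IsLength.le_of_adjacent [d.AtLeastTwo] {ρ : SU d → ℝ} (hρ : IsLength ρ) {r : ℝ}
    (h : ∀ (i : Fin d) γ, ρ (embedPair (ne_succ i) γ) ≤ r) (g : SU d) :
    ρ g ≤ 2 * d ^ 3 * r := by
  have hr : 0 ≤ r := (hρ.nonneg _).trans (h 0 1)
  obtain ⟨l, hl, hn, hx⟩ := pairProd_of_dist_le g le_rfl
  have h1 := hρ.list_prod_le (r := 2 * d * r) l fun x hxl => by
    obtain ⟨i, j, hij, γ, rfl, -⟩ := hx x hxl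
    exact hρ.embedPair_le h hij γ
  have hn' : (l.length : ℝ) ≤ (d * d : ℕ) := by exact_mod_cast hn
  rw [hl] at h1
  calc ρ g ≤ l.length * (2 * d * r) := h1
    _ ≤ (d * d : ℕ) * (2 * d * r) := by gcongr
    _ = _ := by push_cast; ring

end Walk

/-! ### All dimensions together, choice of scale and conclusion -/

/-- Near invariance under the random walk gives near invariance under all of `SU(d)`, with
polynomial dependence on the dimension and polylogarithmic dependence on the scale. -/
theorem displacement_le : ∃ A : ℕ, ∀ (η : Measure (SU 2)) [IsProbabilityMeasure η],
    GeneratesDense η → ∃ c : ℝ, 0 ≤ c ∧ ∀ (d : ℕ) [d.AtLeastTwo],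
      (4 ≤ d ∨ GeneratesDense ((stepMeasure η d).inv.mconv (stepMeasure η d))) →
      ∀ (f : SU d → ℂ) (K : ℝ≥0) (κ : ℝ), LipschitzWith K f → l2Norm f = 1 →
        1 - κ ≤ l2Norm (avgOp η d f) → ∀ ε : ℝ, 0 < ε → ε ≤ 1 → ∀ g,
          displacement f g ≤
            2 * d ^ 3 * (K * ε + c * (1 + Real.log (1 / ε)) ^ A * Real.sqrt (κ * d)) := by
  obtain ⟨A₂, h₂⟩ := displacement_le_of_generatesDense 2
  obtain ⟨A₃, h₃⟩ := displacement_le_of_generatesDense 3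
  obtain ⟨A₄, h₄⟩ := displacement_embedPair_le
  refine ⟨A₂ + A₃ + A₄, fun η _ hη => ?_⟩
  -- The constant must be fixed before the density hypothesis for `d` is available, so it defaults
  -- to `0` when that hypothesis fails. Only the dimensions 2 and 3 need this, so summing the
  -- constants removes the dependence on `d`.
  have aux : ∀ (d : ℕ) [d.AtLeastTwo] (A : ℕ), (∀ (η : Measure (SU 2)) [IsProbabilityMeasure η],
      GeneratesDense ((stepMeasure η d).inv.mconv (stepMeasure η d)) →
      ∃ c : ℝ, 0 ≤ c ∧ ∀ (f : SU d → ℂ) (K : ℝ≥0) (κ : ℝ), LipschitzWith K f → l2Norm f = 1 →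
        1 - κ ≤ l2Norm (avgOp η d f) → ∀ ε : ℝ, 0 < ε → ε ≤ 1 → ∀ g,
          displacement f g ≤ K * ε + c * (1 + Real.log (1 / ε)) ^ A * Real.sqrt κ) →
      ∃ c : ℝ, 0 ≤ c ∧ (GeneratesDense ((stepMeasure η d).inv.mconv (stepMeasure η d)) →
        ∀ (f : SU d → ℂ) (K : ℝ≥0) (κ : ℝ), LipschitzWith K f → l2Norm f = 1 →
        1 - κ ≤ l2Norm (avgOp η d f) → ∀ ε : ℝ, 0 < ε → ε ≤ 1 → ∀ g,
          displacement f g ≤ K * ε + c * (1 + Real.log (1 / ε)) ^ A * Real.sqrt κ) := by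
    intro d _ A h
    by_cases hd : GeneratesDense ((stepMeasure η d).inv.mconv (stepMeasure η d))
    · obtain ⟨c, hc, h'⟩ := h η hd
      exact ⟨c, hc, fun _ => h'⟩
    · exact ⟨0, le_rfl, fun h' => absurd h' hd⟩
  obtain ⟨c₂, hc₂, h₂⟩ := aux 2 A₂ h₂
  obtain ⟨c₃, hc₃, h₃⟩ := aux 3 A₃ h₃
  obtain ⟨c₄, hc₄, h₄⟩ := h₄ η hη
  refine ⟨c₂ + c₃ + c₄, by positivity, fun d _ hd f K κ hf h1 hT ε hε hε1 g => ?_⟩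
  have hd2 : 2 ≤ d := Nat.AtLeastTwo.prop
  have hlog : 1 ≤ 1 + Real.log (1 / ε) := by
    have := Real.log_nonneg (x := 1 / ε) (by rw [le_div_iff₀ hε]; linarith)
    linarith
  have hd1 : (1 : ℝ) ≤ d := by exact_mod_cast (by omega : 1 ≤ d)
  have hκd : Real.sqrt κ ≤ Real.sqrt (κ * d) := by
    rw [Real.sqrt_mul' _ (by positivity)]
    exact le_mul_of_one_le_right (Real.sqrt_nonneg _) (Real.one_le_sqrt.mpr hd1)
  have hcoarse : ∀ (c : ℝ) (A : ℕ), 0 ≤ c → c ≤ c₂ + c₃ + c₄ → A ≤ A₂ + A₃ + A₄ →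
      c * (1 + Real.log (1 / ε)) ^ A * Real.sqrt (κ * d) ≤
        (c₂ + c₃ + c₄) * (1 + Real.log (1 / ε)) ^ (A₂ + A₃ + A₄) * Real.sqrt (κ * d) :=
    fun c A hc hcc hA => by gcongr
  have hsmall : ∀ (c : ℝ) (A : ℕ), 0 ≤ c → c ≤ c₂ + c₃ + c₄ → A ≤ A₂ + A₃ + A₄ →
      displacement f g ≤ K * ε + c * (1 + Real.log (1 / ε)) ^ A * Real.sqrt κ →
      displacement f g ≤ 2 * d ^ 3 * (K * ε +
        (c₂ + c₃ + c₄) * (1 + Real.log (1 / ε)) ^ (A₂ + A₃ + A₄) * Real.sqrt (κ * d)) := by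
    intro c A hc hcc hA h
    have e1 : c * (1 + Real.log (1 / ε)) ^ A * Real.sqrt κ ≤
        c * (1 + Real.log (1 / ε)) ^ A * Real.sqrt (κ * d) := by gcongr
    have e2 := hcoarse c A hc hcc hA
    have e3 : (1 : ℝ) ≤ 2 * d ^ 3 := by
      have := one_le_pow₀ hd1 (n := 3)
      linarith
    refine le_trans ?_ (le_mul_of_one_le_left (by positivity) e3)
    linarith
  rcases le_or_gt 4 d with h4 | h4
  · refine (isLength_displacement hf.continuous).le_of_adjacent (fun i γ => ?_) g
    refine (h₄ d h4 f K κ hf h1 hT ε hε hε1 i γ).trans ?_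
    have := hcoarse c₄ A₄ hc₄ (by linarith) (by omega)
    linarith
  · have hdense := hd.resolve_left (by omega)
    obtain rfl | rfl : d = 2 ∨ d = 3 := by omega
    · exact hsmall c₂ A₂ hc₂ (by linarith) (by omega) (h₂ hdense f K κ hf h1 hT ε hε hε1 g)
    · exact hsmall c₃ A₃ hc₃ (by linarith) (by omega) (h₃ hdense f K κ hf h1 hT ε hε hε1 g)

/-- The numerical choice of scale: with spectral defect `κ`, the displacement bound is below
`1 / 2`. -/
theorem displacement_bound_lt {A : ℕ} {c D L : ℝ} (hc : 0 ≤ c) (hD : 2 ≤ D) (hL : 1 / 4 ≤ L) :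
    2 * D ^ 3 * (L * (1 / (16 * D ^ 3 * (1 + L))) +
      c * (1 + Real.log (1 / (1 / (16 * D ^ 3 * (1 + L))))) ^ A *
        Real.sqrt (((((40 * c * 50 ^ A + 1) * D) ^ (A + 4))⁻¹ *
          (Real.log (1 + L) ^ (A + 1))⁻¹) ^ 2 * D)) < 1 / 2 := by
  set ℓ := Real.log (1 + L) with hℓ
  set c' := 40 * c * 50 ^ A + 1 with hc'
  have hc'1 : 1 ≤ c' := by
    have : 0 ≤ 40 * c * 50 ^ A := by positivity
    linarith
  have hℓ5 : 1 / 5 ≤ ℓ := by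
    have h1 := Real.one_sub_inv_le_log_of_pos (x := 5 / 4) (by norm_num)
    have h2 : Real.log (5 / 4) ≤ ℓ := Real.log_le_log (by norm_num) (by linarith)
    norm_num at h1
    linarith
  have hℓ0 : 0 < ℓ := by linarith
  have hD0 : 0 < D := by linarith
  -- Uses `log x ≤ x - 1` for `16` and `D`; the lower bound `ℓ ≥ 1/5` absorbs the additive constants
  -- into `50Dℓ`.
  have hlog : 1 + Real.log (1 / (1 / (16 * D ^ 3 * (1 + L)))) ≤ 50 * D * ℓ := by
    rw [one_div_one_div, Real.log_mul (by positivity) (by positivity),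
      Real.log_mul (by norm_num) (by positivity), Real.log_pow]
    have h1 := Real.log_le_sub_one_of_pos (x := 16) (by norm_num)
    have h2 := Real.log_le_sub_one_of_pos hD0
    push_cast
    nlinarith
  have hlog0 : 0 ≤ 1 + Real.log (1 / (1 / (16 * D ^ 3 * (1 + L)))) := by
    have : 1 ≤ 16 * D ^ 3 * (1 + L) := by
      have h1 : 1 ≤ D ^ 3 := one_le_pow₀ (by linarith)
      nlinarith
    rw [one_div_one_div]
    have := Real.log_nonneg this
    linarith
  have hfirst : 2 * D ^ 3 * (L * (1 / (16 * D ^ 3 * (1 + L)))) ≤ 1 / 8 := by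
    rw [show 2 * D ^ 3 * (L * (1 / (16 * D ^ 3 * (1 + L)))) = (L / (1 + L)) * (1 / 8) by
      field_simp; norm_num]
    have : L / (1 + L) ≤ 1 := (div_le_one (by linarith)).mpr (by linarith)
    linarith
  have hsqrt : Real.sqrt (((((c' * D) ^ (A + 4))⁻¹ * (ℓ ^ (A + 1))⁻¹) ^ 2) * D) ≤
      ((c' * D) ^ (A + 4))⁻¹ * (ℓ ^ (A + 1))⁻¹ * D := by
    rw [Real.sqrt_mul (by positivity), Real.sqrt_sq (by positivity)]
    refine mul_le_mul_of_nonneg_left ?_ (by positivity)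
    exact Real.sqrt_le_iff.mpr ⟨hD0.le, by nlinarith⟩
  have hsecond : 2 * D ^ 3 * (c * (1 + Real.log (1 / (1 / (16 * D ^ 3 * (1 + L))))) ^ A *
      Real.sqrt (((((c' * D) ^ (A + 4))⁻¹ * (ℓ ^ (A + 1))⁻¹) ^ 2) * D)) ≤ 1 / 4 := by
    -- The powers of `D` are `3` from the word length, `A` from the logarithm and `1` from `√D ≤ D`,
    -- which explains the exponent `A + 4`. One factor `ℓ⁻¹ ≤ 5` is left over.
    calc _ ≤ 2 * D ^ 3 * (c * (50 * D * ℓ) ^ A *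
          (((c' * D) ^ (A + 4))⁻¹ * (ℓ ^ (A + 1))⁻¹ * D)) := by gcongr
      _ = 2 * c * 50 ^ A * (c' ^ (A + 4))⁻¹ * ℓ⁻¹ := by
        rw [mul_pow, mul_pow, mul_pow, pow_succ ℓ, pow_add D]
        field_simp
      _ ≤ 2 * c * 50 ^ A * c'⁻¹ * (1 / 5)⁻¹ := by
        gcongr
        exact le_self_pow₀ hc'1 (by omega)
      _ ≤ 1 / 4 := by
        rw [show 2 * c * 50 ^ A * c'⁻¹ * (1 / 5)⁻¹ = 10 * c * 50 ^ A / c' by ring,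
          div_le_iff₀ (by linarith), hc']
        linarith
  rw [mul_add]
  linarith

end LargeSU

theorem mainTheorem2 :
    ∃ C A : ℝ, 0 < C ∧ 0 < A ∧
      ∀ (η : Measure (LargeSU.SU 2)) [IsProbabilityMeasure η], LargeSU.GeneratesDense η →
        ∃ c : ℝ, 0 < c ∧
          ∀ (d : ℕ) [d.AtLeastTwo],
            (4 ≤ d ∨
              LargeSU.GeneratesDense
                ((LargeSU.stepMeasure η d).inv.mconv (LargeSU.stepMeasure η d))) →
            ∀ f : LargeSU.SU d → ℂ,
              (∃ K : ℝ≥0, LipschitzWith K f) →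
              eLpNorm f 2 (LargeSU.haarSU d) = 1 →
              ∫ x, f x ∂(LargeSU.haarSU d) = 0 →
              eLpNorm (LargeSU.avgOp η d f) 2 (LargeSU.haarSU d) <
                ENNReal.ofReal
                  (1 - (c * (d : ℝ)) ^ (-C) *
                    (Real.log (1 + (LargeSU.lipNorm f : ℝ))) ^ (-A)) := by

  obtain ⟨A, hA⟩ := LargeSU.displacement_le
  -- Displacements are controlled by `√κ`, so the exponents for `κ` itself are doubled.
  refine ⟨2 * (A + 4 : ℕ), 2 * (A + 1 : ℕ), by positivity, by positivity, fun η _ hη => ?_⟩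
  obtain ⟨c, hc, H⟩ := hA η hη
  have hc' : 0 < 40 * c * 50 ^ A + 1 := by positivity
  refine ⟨40 * c * 50 ^ A + 1, hc', fun d _ hd f hLip hf1 hf0 => ?_⟩
  by_contra hlt
  rw [not_lt] at hlt
  have hd2 : (2 : ℝ) ≤ d := by exact_mod_cast Nat.AtLeastTwo.prop (n := d)
  have hf := LargeSU.lipschitzWith_lipNorm hLip
  have h1 : LargeSU.l2Norm f = 1 := by rw [LargeSU.l2Norm, hf1]; rfl
  have hmem := LargeSU.memLp_of_continuous (P := LargeSU.haarSU d)
    (LargeSU.continuous_avgOp η hf)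
  have hT := (ENNReal.ofReal_le_iff_le_toReal hmem.2.ne).mp hlt
  obtain ⟨g, hg⟩ := LargeSU.exists_displacement_gt hf.continuous h1 hf0
  set L : ℝ := (LargeSU.lipNorm f : ℝ) with hLdef
  have hL0 : 0 ≤ L := NNReal.coe_nonneg _
  -- A displacement above `1/2` within diameter 2 forces this, keeping `log(1 + L)` away from zero.
  have hL : 1 / 4 ≤ L := by
    have h2 := LargeSU.displacement_le_dist hf g
    have h3 := LargeSU.dist_le_two g 1
    nlinarith
  have hlog : 0 ≤ Real.log (1 + L) := Real.log_nonneg (by linarith)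
  have hκ : ((40 * c * 50 ^ A + 1) * (d : ℝ)) ^ (-(2 * ((A + 4 : ℕ) : ℝ))) *
      Real.log (1 + L) ^ (-(2 * ((A + 1 : ℕ) : ℝ))) =
      ((((40 * c * 50 ^ A + 1) * (d : ℝ)) ^ (A + 4))⁻¹ * (Real.log (1 + L) ^ (A + 1))⁻¹) ^ 2 := by
    have e : ∀ (x : ℝ) (n : ℕ), 0 ≤ x → x ^ (-(2 * (n : ℝ))) = ((x ^ n)⁻¹) ^ 2 := fun x n hx => by
      rw [Real.rpow_neg hx, mul_comm, Real.rpow_mul hx, Real.rpow_natCast, Real.rpow_two, inv_pow]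
    rw [e _ _ (by positivity), e _ _ hlog, ← mul_pow]
  rw [hκ] at hT
  have hD : 1 ≤ 16 * (d : ℝ) ^ 3 * (1 + L) := by
    have : 1 ≤ (d : ℝ) ^ 3 := one_le_pow₀ (by linarith)
    nlinarith
  have key := H d hd f _ _ hf h1 hT (1 / (16 * (d : ℝ) ^ 3 * (1 + L))) (by positivity)
    ((div_le_one (by positivity)).mpr hD) g
  have := LargeSU.displacement_bound_lt (A := A) hc hd2 hL
  linarith
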